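/- Let $\mathbb{P}^1=\mathbb{P}^1(\mathbb{C})$ and let $G\subset \mathrm{PSU}(2)\cong \mathrm{SO}(3)\subset \mathrm{PSL}_2(\mathbb{C})$ be a group of rotations isomorphic to $A_4$, $S_4$ or $A_5$, acting diagonally on $\mathbb{P}^1\times\mathbb{P}^1$ by $g\cdot(w,z)=(gw,gz)$. Let $k\ge 0$ be an integer and let $\Sigma\subset\mathbb{P}^1\times\mathbb{P}^1$ be a smooth $G$-invariant curve of bidegree $(k,k)$ (that is, the zero locus of a bihomogeneous polynomial of bidegree $(k,k)$ whose gradient does not vanish at any of its zeros), such that the quotient Riemann surface $\Sigma/G$ is an elliptic curve, i.e. biholomorphic to $\mathbb{C}/\Lambda$ for some lattice $\Lambda$. Let $Z=\mathbb{P}^1\times\mathbb{P}^1\setminus\{(w,z): z=-1/\bar w\}$ be the complement of the antidiagonal. Then: 1. if $G\cong A_4$ and $\Sigma\subset Z$, then $k=3$ or $k=4$; 2. if $G\cong S_4$, then $k=4$; 3. if $G\cong A_5$, then $k=6$. -/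

import Mathlib

open scoped LinearAlgebra.Projectivization Topology

noncomputable section

namespace PlatonicCurves

/-- The complex projective line, with homogeneous coordinates indexed by `Fin 2`. -/
abbrev P1 : Type := ℙ ℂ (Fin 2 → ℂ)

/-- The standard topology of the projective line: the quotient topology from the nonzero vectors. -/
instance : TopologicalSpace P1 :=
  inferInstanceAs (TopologicalSpace (Quotient (projectivizationSetoid ℂ (Fin 2 → ℂ))))

/-- Bihomogeneous polynomials of bidegree `(a, b)` in the homogeneous coordinates
`x = (x₀, x₁)` (left) and `y = (y₀, y₁)` (right) of the two factors. -/
def IsBihomogeneous (f : MvPolynomial (Fin 2 ⊕ Fin 2) ℂ) (a b : ℕ) : Prop :=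
  MvPolynomial.IsWeightedHomogeneous
    (Sum.elim (fun _ => ((1, 0) : ℕ × ℕ)) (fun _ => ((0, 1) : ℕ × ℕ))) f (a, b)

/-- The zero locus of a (bihomogeneous) polynomial in the product of two projective lines. -/
def zeroLocus (f : MvPolynomial (Fin 2 ⊕ Fin 2) ℂ) : Set (P1 × P1) :=
  {p | MvPolynomial.eval (Sum.elim p.1.rep p.2.rep) f = 0}

/-- `S` is a smooth `(k, k)` curve: it is the zero locus of a bihomogeneous polynomial of
bidegree `(k, k)` which has a nonvanishing partial derivative at each of its zeros. -/
def IsSmoothCurve (k : ℕ) (S : Set (P1 × P1)) : Prop :=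
  ∃ f : MvPolynomial (Fin 2 ⊕ Fin 2) ℂ, IsBihomogeneous f k k ∧ S = zeroLocus f ∧
    ∀ x y : Fin 2 → ℂ, x ≠ 0 → y ≠ 0 → MvPolynomial.eval (Sum.elim x y) f = 0 →
      ∃ i, MvPolynomial.eval (Sum.elim x y) (MvPolynomial.pderiv i f) ≠ 0

/-- The group `PSL(2, ℂ)`, acting on `P1`, and diagonally on `P1 × P1`. -/
abbrev PSL2 : Type := Matrix.ProjectiveSpecialLinearGroup (Fin 2) ℂ

/-- The rotations (the copy `PSU(2)` of `SO(3)` in `PSL(2, ℂ)`): classes of unitary matrices. -/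
def IsRotation (g : PSL2) : Prop :=
  ∃ A : Matrix.SpecialLinearGroup (Fin 2) ℂ,
    (A : Matrix (Fin 2) (Fin 2) ℂ) ∈ Matrix.unitaryGroup (Fin 2) ℂ ∧
      (QuotientGroup.mk A : PSL2) = g

/-- The antipodal map `w ↦ -1 / conj w` of the projective line; in homogeneous coordinates
`[x₀ : x₁] ↦ [-conj x₁ : conj x₀]`. -/
def antipode (p : P1) : P1 :=
  Projectivization.mk ℂ ![-star (p.rep 1), star (p.rep 0)] (by
    intro h
    apply p.rep_nonzero
    have h0 := congrFun h 0
    have h1 := congrFun h 1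
    ext i
    fin_cases i
    · simpa using h1
    · simpa using h0)

/-- The twistor space of hyperbolic space: the complement of the antidiagonal. -/
def twistorSpace : Set (P1 × P1) := {p | p.2 ≠ antipode p.1}

/-- The equivalence relation on `S` of lying in the same orbit of `G`. -/
abbrev orbitSetoid (G : Subgroup PSL2) (S : Set (P1 × P1)) : Setoid S :=
  (MulAction.orbitRel G (P1 × P1)).comap Subtype.val

/-- The space of orbits `S / G`, with the quotient topology. -/
abbrev OrbitSpace (G : Subgroup PSL2) (S : Set (P1 × P1)) : Type := Quotient (orbitSetoid G S)

/-- The function `φ` on `S` is holomorphic at `p` (i.e. in a neighbourhood of `p` in `S`): near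
homogeneous coordinates `(x, y)` of `p` it is the restriction of a holomorphic function `F`. -/
def HolomorphicAt (S : Set (P1 × P1)) (φ : S → ℂ) (p : S) : Prop :=
  ∃ (x y : Fin 2 → ℂ) (hx : x ≠ 0) (hy : y ≠ 0),
    (p : P1 × P1) = (Projectivization.mk ℂ x hx, Projectivization.mk ℂ y hy) ∧
    ∃ F : (Fin 2 → ℂ) × (Fin 2 → ℂ) → ℂ, AnalyticAt ℂ F (x, y) ∧
      ∀ᶠ v in 𝓝 (x, y), ∀ (h₁ : v.1 ≠ 0) (h₂ : v.2 ≠ 0)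
        (h : (Projectivization.mk ℂ v.1 h₁, Projectivization.mk ℂ v.2 h₂) ∈ S),
        φ ⟨_, h⟩ = F v

/-- The quotient `S / G` is an elliptic curve: it is isomorphic, as a Riemann surface, to a complex
torus `ℂ / Λ`. The holomorphic functions on the quotient are the functions whose pullback to `S`
is holomorphic, so an isomorphism is a homeomorphism which identifies these with the holomorphic
functions of `ℂ / Λ`. -/
def HasEllipticQuotient (G : Subgroup PSL2) (S : Set (P1 × P1)) : Prop :=
  ∃ (L : PeriodPair) (e : OrbitSpace G S ≃ₜ ℂ ⧸ L.lattice),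
    ∀ (φ : ℂ ⧸ L.lattice → ℂ) (p : S) (t : ℂ), e (Quotient.mk _ p) = L.lattice.mkQ t →
      (AnalyticAt ℂ (fun s => φ (L.lattice.mkQ s)) t ↔
        HolomorphicAt S (fun q => φ (e (Quotient.mk _ q))) p)

end PlatonicCurves

end

noncomputable section

namespace PlatonicCurves

open Filter Matrix MvPolynomial Equiv

/-! Let `f = 0` be the equation of the curve. A form `h` of bidegree `(k - 2, k - 2)` defines the
holomorphic differential `h (x ∧ dx) / (∂f / ∂y)` on the curve. If `f` and `h` are `G`-invariant,
this differential descends to the elliptic curve, where every holomorphic differential is a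
constant multiple of `dt`. Two invariant forms of bidegree `(k - 2, k - 2)` are therefore linearly
dependent along the curve, and then linearly dependent, because `f` does not divide a nonzero form
of smaller bidegree.

Let `D` be the equation of the diagonal, and `P` the product of the bilinear forms attached to the
axes of a conjugacy class of rotations, of bidegree `(j, j)`. Then `P` does not vanish identically
on the diagonal, so `P D ^ (k - 2 - j)` and `D ^ (k - 2)` are independent if `0 < j ≤ k - 2`. This
bounds `k` from above: `k ≤ j + 1` when `P` itself is invariant, and `k ≤ 2 j + 1` when only `P ^ 2`
is.

The character by which `G` acts on `f` is trivial, for group-theoretic reasons or because it can be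
read off at the fixed points of the rotations. At a fixed point `(x, x)` of a rotation of order
`n`, comparing the weights of the rotation on the value of `f`, or on its differential if the value
is `0`, shows that `n` divides `k` or `k - 1`. Finally `k ≥ 2`, since a smooth curve of bidegree
`(1, 1)` is rational and cannot cover an elliptic curve.
-/

section ComplexAnalysis

lemma fderiv_apply_eq_of_forall_line {𝕜 E : Type*} [NontriviallyNormedField 𝕜]
    [NormedAddCommGroup E] [NormedSpace 𝕜 E] {f : E → 𝕜} {v a : E} {b c : 𝕜}
    (hf : DifferentiableAt 𝕜 f v) (h : ∀ s : 𝕜, f (v + s • a) = b + s * c) :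
    fderiv 𝕜 f v a = c := by
  rw [← hf.lineDeriv_eq_fderiv, lineDeriv, funext h]
  simp

lemma fderiv_apply_of_semiinvariant {𝕜 E : Type*} [NontriviallyNormedField 𝕜]
    [NormedAddCommGroup E] [NormedSpace 𝕜 E] {f : E → 𝕜} (hf : Differentiable 𝕜 f)
    (M : E →L[𝕜] E) (c : 𝕜) (h : ∀ v, f (M v) = c * f v) (v w : E) :
    fderiv 𝕜 f (M v) (M w) = c * fderiv 𝕜 f v w := by
  have hcomp : HasFDerivAt (f ∘ M) ((fderiv 𝕜 f (M v)).comp M) v :=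
    (hf (M v)).hasFDerivAt.comp v M.hasFDerivAt
  have hmul : HasFDerivAt (f ∘ M) (c • fderiv 𝕜 f v) v := by
    rw [show f ∘ M = fun v => c * f v from funext h]
    exact (hf v).hasFDerivAt.const_mul c
  simpa using DFunLike.congr_fun (hcomp.unique hmul) w

lemma exists_analytic_implicit {E : Type*} [NormedAddCommGroup E] [NormedSpace ℂ E] {f : E → ℂ}
    {v : E} (a : E) {b : E} (hf : AnalyticAt ℂ f v) (hb : fderiv ℂ f v b ≠ 0) :
    ∃ τ : ℂ → ℂ, AnalyticAt ℂ τ 0 ∧ τ 0 = 0 ∧ ∀ᶠ s in 𝓝 0, f (v + s • a + τ s • b) = f v := by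
  let ℓ : ℂ × ℂ →L[ℂ] E :=
    (ContinuousLinearMap.fst ℂ ℂ ℂ).smulRight a + (ContinuousLinearMap.snd ℂ ℂ ℂ).smulRight b
  let φ : ℂ × ℂ → ℂ := fun p => f (v + ℓ p)
  have hℓ : v + ℓ (0, 0) = v := by simp [ℓ]
  have hφ : AnalyticAt ℂ φ (0, 0) := by
    refine AnalyticAt.fun_comp (g := f) ?_ (analyticAt_const.add (ℓ.analyticAt _))
    rwa [hℓ]
  have hφ' : HasFDerivAt φ ((fderiv ℂ f v).comp ℓ) (0, 0) := by
    refine HasFDerivAt.comp (g := f) (0, 0) ?_ (ℓ.hasFDerivAt.const_add v)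
    rw [hℓ]
    exact hf.differentiableAt.hasFDerivAt
  have hc : ContDiffAt ℂ ⊤ φ (0, 0) := hφ.contDiffAt
  have hinv : (fderiv ℂ φ (0, 0) ∘L .inr ℂ ℂ ℂ).IsInvertible := by
    refine ⟨ContinuousLinearEquiv.unitsEquivAut ℂ (Units.mk0 _ hb), ?_⟩
    ext
    simp [hφ'.fderiv, ℓ]
  refine ⟨hc.implicitFunction (by simp) hinv,
    (hc.contDiffAt_implicitFunction (by simp) hinv).analyticAt,
    hc.implicitFunction_apply_self (by simp) hinv, ?_⟩
  filter_upwards [hc.eventually_apply_implicitFunction (by simp) hinv] with s hs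
  simpa [φ, ℓ, add_assoc] using hs

lemma exists_analytic_right_inverse {T : ℂ → ℂ} {s : ℂ} (hT : AnalyticAt ℂ T s)
    (hd : deriv T s ≠ 0) :
    ∃ σ : ℂ → ℂ, AnalyticAt ℂ σ (T s) ∧ σ (T s) = s ∧ ∀ᶠ t in 𝓝 (T s), T (σ t) = t := by
  have hd' : HasFDerivAt T
      (ContinuousLinearEquiv.unitsEquivAut ℂ (Units.mk0 _ hd) : ℂ →L[ℂ] ℂ) s := by
    convert! hT.differentiableAt.hasDerivAt.hasFDerivAt using 1
  have hc : ContDiffAt ℂ ⊤ T s := hT.contDiffAt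
  exact ⟨hc.localInverse hd' (by simp), (hc.to_localInverse hd' (by simp)).analyticAt,
    hc.localInverse_apply_image hd' (by simp),
    (hc.hasStrictFDerivAt' hd' (by simp)).eventually_right_inverse⟩

lemma eventually_deriv_ne_zero {T : ℂ → ℂ} {s₀ : ℂ} (hT : AnalyticAt ℂ T s₀)
    (hne : ¬ ∀ᶠ s in 𝓝 s₀, T s = T s₀) : ∀ᶠ s in 𝓝[≠] s₀, deriv T s ≠ 0 := by
  refine hT.deriv.eventually_eq_zero_or_eventually_ne_zero.resolve_left fun h0 => hne ?_
  obtain ⟨ε, hε, hball⟩ := Metric.eventually_nhds_iff_ball.1 (h0.and hT.eventually_analyticAt)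
  obtain ⟨a, ha⟩ := Metric.isOpen_ball.exists_is_const_of_deriv_eq_zero
    (convex_ball s₀ ε).isPreconnected
    (fun s hs => (hball s hs).2.differentiableAt.differentiableWithinAt) fun s hs => (hball s hs).1
  filter_upwards [Metric.ball_mem_nhds s₀ hε] with s hs
  rw [ha s hs, ha s₀ (Metric.mem_ball_self hε)]

lemma eventually_deriv_eq_pow_mul {T g : ℂ → ℂ} {s₀ c : ℂ} {m : ℕ} (hg : AnalyticAt ℂ g s₀)
    (hT : ∀ᶠ s in 𝓝 s₀, T s = (s - s₀) ^ (m + 1) * g s + c) :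
    ∀ᶠ s in 𝓝 s₀, deriv T s = (s - s₀) ^ m * ((m + 1) * g s + (s - s₀) * deriv g s) := by
  filter_upwards [hT.eventually_nhds, hg.eventually_analyticAt] with s hs hgs
  have hpow := (((hasDerivAt_id s).sub_const s₀).pow (m + 1)).mul hgs.differentiableAt.hasDerivAt
  rw [((hpow.add_const c).congr_of_eventuallyEq hs).deriv]
  simp only [id_eq, Nat.add_sub_cancel, mul_one, Pi.pow_apply]
  push_cast
  ring

lemma tendsto_sub_div_deriv {T : ℂ → ℂ} {s₀ : ℂ} (hT : AnalyticAt ℂ T s₀) :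
    Tendsto (fun s => (T s - T s₀) / deriv T s) (𝓝[≠] s₀) (𝓝 0) := by
  by_cases hne : ∀ᶠ s in 𝓝 s₀, T s = T s₀
  · refine tendsto_const_nhds.congr' ?_
    filter_upwards [hne.filter_mono nhdsWithin_le_nhds] with s hs
    rw [hs, sub_self, zero_div]
  obtain ⟨n, g, hg, hg0, he⟩ :=
    (hT.sub analyticAt_const).exists_eventuallyEq_pow_smul_nonzero_iff.2
      (show ¬ ∀ᶠ s in 𝓝 s₀, T s - T s₀ = 0 by simpa only [sub_eq_zero] using hne)
  obtain _ | m := n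
  · have := he.self_of_nhds
    simp only [Pi.sub_apply, sub_self, pow_zero, one_smul] at this
    exact absurd this.symm hg0
  have hden : AnalyticAt ℂ (fun s => (m + 1 : ℂ) * g s + (s - s₀) * deriv g s) s₀ :=
    (analyticAt_const.mul hg).add ((analyticAt_id.sub analyticAt_const).mul hg.deriv)
  have hden0 : (m + 1 : ℂ) * g s₀ + (s₀ - s₀) * deriv g s₀ ≠ 0 := by
    simpa [hg0] using m.cast_add_one_ne_zero
  have hderiv := eventually_deriv_eq_pow_mul (T := T) (c := T s₀) hg (he.mono fun s hs => by
    rw [← smul_eq_mul, ← hs, Pi.sub_apply, sub_add_cancel])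
  have hlim : Tendsto (fun s => (s - s₀) * g s / ((m + 1 : ℂ) * g s + (s - s₀) * deriv g s))
      (𝓝[≠] s₀) (𝓝 0) := by
    have hnum : AnalyticAt ℂ (fun s => (s - s₀) * g s) s₀ :=
      (analyticAt_id.sub analyticAt_const).mul hg
    have := (hnum.fun_div hden hden0).continuousAt.tendsto
    simp only [sub_self, zero_mul, zero_div] at this
    exact this.mono_left nhdsWithin_le_nhds
  refine hlim.congr' ?_
  filter_upwards [(he.and hderiv).filter_mono nhdsWithin_le_nhds, self_mem_nhdsWithin]
    with s ⟨hs, hds⟩ hne'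
  have : s - s₀ ≠ 0 := sub_ne_zero.2 hne'
  simp only [Pi.sub_apply, smul_eq_mul] at hs
  rw [hds, hs, pow_succ, mul_assoc, mul_div_mul_left _ _ (pow_ne_zero m this)]

lemma punctured_nhds_le_map {X Y : Type*} [TopologicalSpace X] [TopologicalSpace Y] {f : X → Y}
    {x : X} (h : 𝓝 (f x) ≤ map f (𝓝 x)) : 𝓝[≠] (f x) ≤ map f (𝓝[≠] x) := by
  intro s hs
  rw [mem_map, mem_nhdsWithin_iff_eventually] at hs
  refine mem_nhdsWithin_iff_eventually.2 (h (mem_map.2 ?_))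
  filter_upwards [hs] with y hy hne
  exact hy fun hyx => hne (congrArg f hyx)

lemma exists_entire_extension {u : ℂ → ℂ} (ha : ∀ t₀, ∀ᶠ t in 𝓝[≠] t₀, AnalyticAt ℂ u t)
    (ho : ∀ t₀, Tendsto (fun t => (t - t₀) * u t) (𝓝[≠] t₀) (𝓝 0)) :
    ∃ U : ℂ → ℂ, Differentiable ℂ U ∧ ∀ t₀, Tendsto u (𝓝[≠] t₀) (𝓝 (U t₀)) := by
  let U : ℂ → ℂ := fun t => limUnder (𝓝[≠] t) u
  have hlim : ∀ t₀, Tendsto u (𝓝[≠] t₀) (𝓝 (U t₀)) := by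
    intro t₀
    refine Complex.tendsto_limUnder_of_differentiable_on_punctured_nhds_of_isLittleO
      ((ha t₀).mono fun t ht => ht.differentiableAt) ?_
    rw [Asymptotics.isLittleO_iff_tendsto']
    · have hconst : Tendsto (fun t => (t - t₀) * u t₀) (𝓝[≠] t₀) (𝓝 0) := by
        have : ContinuousAt (fun t => (t - t₀) * u t₀) t₀ := by fun_prop
        simpa using this.tendsto.mono_left nhdsWithin_le_nhds
      rw [← sub_zero (0 : ℂ)]
      refine ((ho t₀).sub hconst).congr fun t => ?_
      rw [div_inv_eq_mul]
      ring
    · filter_upwards [self_mem_nhdsWithin] with t ht h0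
      exact absurd h0 (inv_ne_zero (sub_ne_zero.2 ht))
  have hU : ∀ t, AnalyticAt ℂ u t → U t = u t := fun t ht =>
    (ht.continuousAt.tendsto.mono_left nhdsWithin_le_nhds).limUnder_eq
  refine ⟨U, fun t₀ => AnalyticAt.differentiableAt ?_, hlim⟩
  refine Complex.analyticAt_of_differentiable_on_punctured_nhds_of_continuousAt ?_ ?_
  · filter_upwards [ha t₀] with t ht
    exact (ht.congr (ht.eventually_analyticAt.mono fun r hr => (hU r hr).symm)).differentiableAt
  · rw [continuousAt_iff_punctured_nhds]
    refine (hlim t₀).congr' ?_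
    filter_upwards [ha t₀] with t ht using (hU t ht).symm

lemma exists_const_of_lattice_periodic (L : PeriodPair) {u : ℂ → ℂ}
    (hp : ∀ t, ∀ l ∈ L.lattice, u (t + l) = u t)
    (ha : ∀ t₀, ∀ᶠ t in 𝓝[≠] t₀, AnalyticAt ℂ u t)
    (ho : ∀ t₀, Tendsto (fun t => (t - t₀) * u t) (𝓝[≠] t₀) (𝓝 0)) :
    ∃ c, ∀ t, ContinuousAt u t → u t = c := by
  obtain ⟨U, hU, hlim⟩ := exists_entire_extension ha ho
  have hUp : ∀ t, ∀ l ∈ L.lattice, U (t + l) = U t := by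
    intro t l hl
    have hshift : Tendsto (fun r => r + l) (𝓝[≠] t) (𝓝[≠] (t + l)) :=
      (continuous_add_const l).continuousAt.continuousWithinAt.tendsto_nhdsWithin
        fun r hr => by simpa using hr
    exact tendsto_nhds_unique (((hlim (t + l)).comp hshift).congr fun r => hp r l hl) (hlim t)
  have hcompact := IsZLattice.isCompact_range_of_periodic L.lattice U hU.continuous hUp
  obtain ⟨c, hc⟩ := hU.exists_const_forall_eq_of_bounded hcompact.isBounded
  refine ⟨c, fun t ht => ?_⟩
  rw [← hc t]
  exact tendsto_nhds_unique (ht.tendsto.mono_left nhdsWithin_le_nhds) (hlim t)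

/-- The hypothesis says that `D₁ ds` and `D₂ dr` are the same differential in the two affine
coordinates `s` and `r = s⁻¹` of the projective line. -/
lemma eq_zero_of_entire_differential {D₁ D₂ : ℂ → ℂ} (h₁ : Differentiable ℂ D₁)
    (h₂ : Differentiable ℂ D₂) (h : ∀ s, s ≠ 0 → D₁ s = -(s⁻¹ ^ 2 * D₂ s⁻¹)) (s : ℂ) :
    D₁ s = 0 := by
  refine h₁.apply_eq_of_tendsto_cocompact s ?_
  have hinv : Tendsto (fun s : ℂ => s⁻¹) (cocompact ℂ) (𝓝 0) :=
    Metric.cobounded_eq_cocompact (α := ℂ) ▸ tendsto_inv₀_cobounded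
  have hlim : Tendsto (fun r => -(r ^ 2 * D₂ r)) (𝓝 0) (𝓝 0) := by
    have : Continuous fun r => -(r ^ 2 * D₂ r) := ((continuous_pow 2).mul h₂.continuous).neg
    simpa using this.tendsto 0
  refine (hlim.comp hinv).congr' ?_
  filter_upwards [(isCompact_singleton (x := (0 : ℂ))).compl_mem_cocompact] with s hs
  exact (h s hs).symm

end ComplexAnalysis

section Plane

/-- The standard area form `x ∧ y = x₀ y₁ - x₁ y₀` of the plane. -/
def area {R : Type*} [CommRing R] (x y : Fin 2 → R) : R := x 0 * y 1 - x 1 * y 0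

section CommRing

variable {R : Type*} [CommRing R]

lemma area_self (x : Fin 2 → R) : area x x = 0 := by
  simp only [area]
  ring

lemma area_swap (x y : Fin 2 → R) : area y x = -area x y := by
  simp only [area]
  ring

lemma area_zero_left (y : Fin 2 → R) : area 0 y = 0 := by
  simp [area]

lemma area_smul_left (a : R) (x y : Fin 2 → R) : area (a • x) y = a * area x y := by
  simp only [area, Pi.smul_apply, smul_eq_mul]
  ring

lemma area_smul_right (a : R) (x y : Fin 2 → R) : area x (a • y) = a * area x y := by
  simp only [area, Pi.smul_apply, smul_eq_mul]
  ring

lemma area_mulVec (A : SpecialLinearGroup (Fin 2) R) (x y : Fin 2 → R) :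
    area (A.1 *ᵥ x) (A.1 *ᵥ y) = area x y := by
  have hdet := A.2
  rw [det_fin_two] at hdet
  simp only [area, mulVec, dotProduct, Fin.sum_univ_two]
  linear_combination (x 0 * y 1 - x 1 * y 0) * hdet

lemma map_area {R' F : Type*} [CommRing R'] [FunLike F R R'] [RingHomClass F R R'] (φ : F)
    (x y : Fin 2 → R) : φ (area x y) = area (φ ∘ x) (φ ∘ y) := by
  simp [area]

lemma eq_area_smul_add {x z : Fin 2 → R} (hxz : area x z = 1) (w : Fin 2 → R) :
    w = area x w • z + area w z • x := by
  simp only [area] at *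
  ext i
  fin_cases i
  · simp only [Fin.zero_eta, Pi.add_apply, Pi.smul_apply, smul_eq_mul]
    linear_combination -(w 0) * hxz
  · simp only [Fin.mk_one, Pi.add_apply, Pi.smul_apply, smul_eq_mul]
    linear_combination -(w 1) * hxz

lemma mulVec_ne_zero (A : SpecialLinearGroup (Fin 2) R) {x : Fin 2 → R} (hx : x ≠ 0) :
    A.1 *ᵥ x ≠ 0 := by
  have hA : IsUnit A.1 := (isUnit_iff_isUnit_det _).2 (by simp [A.2])
  simpa only [mulVec_zero] using (mulVec_injective_of_isUnit hA).ne hx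

end CommRing

section Field

variable {K : Type*} [Field K]

lemma exists_area_eq_one {x : Fin 2 → K} (hx : x ≠ 0) : ∃ y, area x y = 1 := by
  by_cases h0 : x 0 = 0
  · have h1 : x 1 ≠ 0 := fun h1 => hx (by ext i; fin_cases i <;> simp [h0, h1])
    exact ⟨![-(x 1)⁻¹, 0], by simp [area, h1]⟩
  · exact ⟨![0, (x 0)⁻¹], by simp [area, h0]⟩

lemma eq_smul_of_area_eq_zero {x y : Fin 2 → K} (hx : x ≠ 0) (h : area x y = 0) :
    ∃ a : K, y = a • x := by
  obtain ⟨z, hz⟩ := exists_area_eq_one hx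
  refine ⟨area y z, ?_⟩
  conv_lhs => rw [eq_area_smul_add hz y, h, zero_smul, zero_add]

end Field

lemma analyticAt_area {E : Type*} [NormedAddCommGroup E] [NormedSpace ℂ E]
    {x y : E → Fin 2 → ℂ} {v : E} (hx : AnalyticAt ℂ x v) (hy : AnalyticAt ℂ y v) :
    AnalyticAt ℂ (fun w => area (x w) (y w)) v := by
  rw [analyticAt_pi_iff] at hx hy
  exact ((hx 0).mul (hy 1)).sub ((hx 1).mul (hy 0))

lemma hasDerivAt_area {x y : ℂ → Fin 2 → ℂ} {x' y' : Fin 2 → ℂ} {s : ℂ} (hx : HasDerivAt x x' s)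
    (hy : HasDerivAt y y' s) :
    HasDerivAt (fun r => area (x r) (y r)) (area x' (y s) + area (x s) y') s := by
  rw [hasDerivAt_pi] at hx hy
  refine (((hx 0).mul (hy 1)).sub ((hx 1).mul (hy 0))).congr_deriv ?_
  simp only [area]
  ring

lemma area_deriv_of_eventually_area_eq_zero {x y : ℂ → Fin 2 → ℂ} {x' y' : Fin 2 → ℂ} {s a : ℂ}
    (hx : HasDerivAt x x' s) (hy : HasDerivAt y y' s) (h : ∀ᶠ r in 𝓝 s, area (x r) (y r) = 0)
    (ha : y s = a • x s) : area (y s) y' = a ^ 2 * area (x s) x' := by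
  have hzero := ((hasDerivAt_area hx hy).congr_of_eventuallyEq
    (h.mono fun r hr => hr.symm)).unique (hasDerivAt_const s 0)
  rw [ha, area_smul_right, area_swap] at hzero
  rw [ha, area_smul_left]
  linear_combination a * hzero

end Plane

section SmoothEquations

/-- Pairs of homogeneous coordinates on the two factors of `ℙ¹ × ℙ¹`. -/
abbrev Coord : Type := (Fin 2 → ℂ) × (Fin 2 → ℂ)

/-- The cone over the curve `f = 0`. -/
def cone (f : Coord → ℂ) : Set Coord := {v | v.1 ≠ 0 ∧ v.2 ≠ 0 ∧ f v = 0}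

/-- Multiplication by scalars on the two factors. -/
def scaleL (a b : ℂ) : Coord →L[ℂ] Coord :=
  (a • ContinuousLinearMap.id ℂ (Fin 2 → ℂ)).prodMap (b • ContinuousLinearMap.id ℂ (Fin 2 → ℂ))

/-- The diagonal action of a matrix. -/
def diagL (A : Matrix (Fin 2) (Fin 2) ℂ) : Coord →L[ℂ] Coord :=
  (LinearMap.toContinuousLinearMap A.mulVecLin).prodMap
    (LinearMap.toContinuousLinearMap A.mulVecLin)

@[simp] lemma scaleL_apply (a b : ℂ) (v : Coord) : scaleL a b v = (a • v.1, b • v.2) := rfl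

@[simp] lemma diagL_apply (A : Matrix (Fin 2) (Fin 2) ℂ) (v : Coord) :
    diagL A v = (A *ᵥ v.1, A *ᵥ v.2) := rfl

/-- Entire functions which are homogeneous of the same degree `m` in both variables. -/
structure IsEntireForm (h : Coord → ℂ) (m : ℕ) : Prop where
  analytic : ∀ v, AnalyticAt ℂ h v
  map_scaleL : ∀ a b v, h (scaleL a b v) = a ^ m * b ^ m * h v

/-- `f = 0` is a smooth curve of bidegree `(k, k)`. -/
structure SmoothEquation (f : Coord → ℂ) (k : ℕ) : Prop extends IsEntireForm f k where
  fderiv_ne_zero : ∀ v ∈ cone f, fderiv ℂ f v ≠ 0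

/-- The curve in `ℙ¹ × ℙ¹` passing through `v` with velocity `v'` has nonzero velocity: the
derivative of the point `[x]` of `ℙ¹` is measured by `area x x'`. -/
def IsImmersed (v v' : Coord) : Prop := area v.1 v'.1 ≠ 0 ∨ area v.2 v'.2 ≠ 0

variable {f : Coord → ℂ} {k : ℕ}

namespace IsEntireForm

lemma differentiable (hf : IsEntireForm f k) : Differentiable ℂ f :=
  fun v => (hf.analytic v).differentiableAt

lemma fderiv_scaleL (hf : IsEntireForm f k) (a b : ℂ) (v w : Coord) :
    fderiv ℂ f (scaleL a b v) (scaleL a b w) = a ^ k * b ^ k * fderiv ℂ f v w :=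
  fderiv_apply_of_semiinvariant hf.differentiable (scaleL a b) _ (hf.map_scaleL a b) v w

lemma fderiv_left (hf : IsEntireForm f k) {v : Coord} (hv : f v = 0) :
    fderiv ℂ f v (v.1, 0) = 0 := by
  refine fderiv_apply_eq_of_forall_line (b := 0) (hf.differentiable v) fun s => ?_
  have : v + s • ((v.1, 0) : Coord) = scaleL (1 + s) 1 v := by ext <;> simp [add_mul]
  rw [this, hf.map_scaleL, hv, mul_zero, mul_zero, add_zero]

lemma fderiv_right (hf : IsEntireForm f k) {v : Coord} (hv : f v = 0) :
    fderiv ℂ f v (0, v.2) = 0 := by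
  refine fderiv_apply_eq_of_forall_line (b := 0) (hf.differentiable v) fun s => ?_
  have : v + s • ((0, v.2) : Coord) = scaleL 1 (1 + s) v := by ext <;> simp [add_mul]
  rw [this, hf.map_scaleL, hv, mul_zero, mul_zero, add_zero]

lemma fderiv_apply_eq (hf : IsEntireForm f k) {v : Coord} (hv : f v = 0) {x y : Fin 2 → ℂ}
    (hx : area v.1 x = 1) (hy : area v.2 y = 1) (w : Coord) :
    fderiv ℂ f v w = area v.1 w.1 * fderiv ℂ f v (x, 0) + area v.2 w.2 * fderiv ℂ f v (0, y) := by
  have hw : w = area v.1 w.1 • ((x, 0) : Coord) + area w.1 x • ((v.1, 0) : Coord) +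
      (area v.2 w.2 • ((0, y) : Coord) + area w.2 y • ((0, v.2) : Coord)) := by
    ext1
    · simpa using eq_area_smul_add hx w.1
    · simpa using eq_area_smul_add hy w.2
  conv_lhs => rw [hw]
  simp only [map_add, map_smul, hf.fderiv_left hv, hf.fderiv_right hv, smul_eq_mul]
  ring

end IsEntireForm

lemma eventually_mem_cone {X : Type*} [TopologicalSpace X] {γ : X → Coord} {s₀ : X}
    (hγ : ContinuousAt γ s₀) (h₀ : γ s₀ ∈ cone f) (h : ∀ᶠ s in 𝓝 s₀, f (γ s) = 0) :
    ∀ᶠ s in 𝓝 s₀, γ s ∈ cone f := by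
  filter_upwards [hγ.fst.eventually_ne h₀.1, hγ.snd.eventually_ne h₀.2.1, h]
    with s h₁ h₂ h₃ using ⟨h₁, h₂, h₃⟩

lemma exists_param_of_fderiv_ne_zero {v b : Coord} (a : Coord) (hf : AnalyticAt ℂ f v)
    (hv : v ∈ cone f) (hb : fderiv ℂ f v b ≠ 0) :
    ∃ γ : ℂ → Coord, AnalyticAt ℂ γ 0 ∧ γ 0 = v ∧ (∀ᶠ s in 𝓝 0, γ s ∈ cone f) ∧
      ∃ c : ℂ, deriv γ 0 = a + c • b := by
  obtain ⟨τ, hτ, hτ₀, hτf⟩ := exists_analytic_implicit a hf hb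
  have hγ : AnalyticAt ℂ (fun s => v + s • a + τ s • b) 0 :=
    (analyticAt_const.add (analyticAt_id.smul analyticAt_const)).add (hτ.smul analyticAt_const)
  have hγ₀ : v + (0 : ℂ) • a + τ 0 • b = v := by simp [hτ₀]
  refine ⟨_, hγ, hγ₀, eventually_mem_cone hγ.continuousAt (by rwa [hγ₀])
    (hτf.mono fun s hs => hs.trans hv.2.2), deriv τ 0, HasDerivAt.deriv ?_⟩
  have hline : HasDerivAt (fun s : ℂ => v + s • a) a 0 := by
    simpa using ((hasDerivAt_id (0 : ℂ)).smul_const a).const_add v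
  exact hline.add (hτ.differentiableAt.hasDerivAt.smul_const b)

lemma SmoothEquation.fderiv_ne_zero_or (hf : SmoothEquation f k) {v : Coord} (hv : v ∈ cone f)
    {x y : Fin 2 → ℂ} (hx : area v.1 x ≠ 0) (hy : area v.2 y ≠ 0) :
    fderiv ℂ f v (x, 0) ≠ 0 ∨ fderiv ℂ f v (0, y) ≠ 0 := by
  by_contra! h₀
  have hx₁ : area v.1 ((area v.1 x)⁻¹ • x) = 1 := by rw [area_smul_right, inv_mul_cancel₀ hx]
  have hy₁ : area v.2 ((area v.2 y)⁻¹ • y) = 1 := by rw [area_smul_right, inv_mul_cancel₀ hy]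
  have hx₀ : fderiv ℂ f v ((area v.1 x)⁻¹ • x, 0) = 0 := by
    rw [← smul_zero (area v.1 x)⁻¹, ← Prod.smul_mk, map_smul, h₀.1, smul_zero]
  have hy₀ : fderiv ℂ f v (0, (area v.2 y)⁻¹ • y) = 0 := by
    rw [← smul_zero (area v.2 y)⁻¹, ← Prod.smul_mk, map_smul, h₀.2, smul_zero]
  refine hf.fderiv_ne_zero v hv (ContinuousLinearMap.ext fun w => ?_)
  rw [hf.fderiv_apply_eq hv.2.2 hx₁ hy₁ w, hx₀, hy₀, mul_zero, mul_zero, add_zero]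
  rfl

lemma SmoothEquation.exists_param (hf : SmoothEquation f k) {v : Coord} (hv : v ∈ cone f) :
    ∃ γ : ℂ → Coord, AnalyticAt ℂ γ 0 ∧ γ 0 = v ∧ (∀ᶠ s in 𝓝 0, γ s ∈ cone f) ∧
      IsImmersed v (deriv γ 0) := by
  obtain ⟨x, hx⟩ := exists_area_eq_one hv.1
  obtain ⟨y, hy⟩ := exists_area_eq_one hv.2.1
  rcases hf.fderiv_ne_zero_or hv (hx ▸ one_ne_zero) (hy ▸ one_ne_zero) with h | h
  · obtain ⟨γ, hγ, hγ₀, hc, c, hd⟩ := exists_param_of_fderiv_ne_zero (0, y) (hf.analytic v) hv h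
    exact ⟨γ, hγ, hγ₀, hc, Or.inr (by simp [hd, hy])⟩
  · obtain ⟨γ, hγ, hγ₀, hc, c, hd⟩ := exists_param_of_fderiv_ne_zero (x, 0) (hf.analytic v) hv h
    exact ⟨γ, hγ, hγ₀, hc, Or.inl (by simp [hd, hx])⟩

end SmoothEquations

section TorusMaps

/-- The vectors `v` and `w` represent the same point of `ℙ¹ × ℙ¹`. -/
def SamePoint (v w : Coord) : Prop := area v.1 w.1 = 0 ∧ area v.2 w.2 = 0

/-- The velocities `v'` at `v` and `u'` at `u` represent the same tangent vector of `ℙ¹ × ℙ¹`: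
velocities are measured by `area`, which is quadratic in the choice of representatives. -/
def SameTangent (v v' u u' : Coord) : Prop :=
  ∃ a b : ℂ, u = scaleL a b v ∧ area u.1 u'.1 = a ^ 2 * area v.1 v'.1 ∧
    area u.2 u'.2 = b ^ 2 * area v.2 v'.2

lemma sameTangent_of_eventually_samePoint {γ δ : ℂ → Coord} {γ' δ' : Coord} {s : ℂ}
    (hγ : HasDerivAt γ γ' s) (hδ : HasDerivAt δ δ' s)
    (h : ∀ᶠ r in 𝓝 s, SamePoint (γ r) (δ r)) (h₁ : (γ s).1 ≠ 0) (h₂ : (γ s).2 ≠ 0) :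
    SameTangent (γ s) γ' (δ s) δ' := by
  have hfst {α : ℂ → Coord} {α' : Coord} (hα : HasDerivAt α α' s) :
      HasDerivAt (fun r => (α r).1) α'.1 s :=
    (ContinuousLinearMap.fst ℂ (Fin 2 → ℂ) (Fin 2 → ℂ)).hasFDerivAt.comp_hasDerivAt s hα
  have hsnd {α : ℂ → Coord} {α' : Coord} (hα : HasDerivAt α α' s) :
      HasDerivAt (fun r => (α r).2) α'.2 s :=
    (ContinuousLinearMap.snd ℂ (Fin 2 → ℂ) (Fin 2 → ℂ)).hasFDerivAt.comp_hasDerivAt s hα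
  obtain ⟨a, ha⟩ := eq_smul_of_area_eq_zero h₁ h.self_of_nhds.1
  obtain ⟨b, hb⟩ := eq_smul_of_area_eq_zero h₂ h.self_of_nhds.2
  exact ⟨a, b, Prod.ext ha hb,
    area_deriv_of_eventually_area_eq_zero (hfst hγ) (hfst hδ) (h.mono fun r hr => hr.1) ha,
    area_deriv_of_eventually_area_eq_zero (hsnd hγ) (hsnd hδ) (h.mono fun r hr => hr.2) hb⟩

lemma not_isImmersed_of_sameTangent_zero {v u u' : Coord} (h : SameTangent v 0 u u') :
    ¬ IsImmersed u u' := by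
  obtain ⟨a, b, -, h₁, h₂⟩ := h
  have hzero (x : Fin 2 → ℂ) : area x 0 = 0 := by simp [area]
  rw [IsImmersed, h₁, h₂, Prod.fst_zero, Prod.snd_zero, hzero, hzero]
  simp

variable {ι : Type*} {f : Coord → ℂ} {L : PeriodPair} {A : ι → SpecialLinearGroup (Fin 2) ℂ}
  {q : Coord → ℂ ⧸ L.lattice}

/-- A map from the cone over the curve `f = 0` to the torus `ℂ / Λ`, constant on lines, surjective,
whose fibres lie in the orbits of the matrices `A i`, and which lifts locally to holomorphic
functions. -/
structure TorusMap (f : Coord → ℂ) (L : PeriodPair) (A : ι → SpecialLinearGroup (Fin 2) ℂ)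
    (q : Coord → ℂ ⧸ L.lattice) : Prop where
  exists_eq : ∀ t : ℂ, ∃ v ∈ cone f, L.lattice.mkQ t = q v
  map_smul : ∀ v ∈ cone f, ∀ a : ℂ, a ≠ 0 → q (a • v) = q v
  exists_samePoint : ∀ v ∈ cone f, ∀ w ∈ cone f, q v = q w → ∃ i, SamePoint (diagL (A i).1 v) w
  exists_lift : ∀ v ∈ cone f, ∀ t : ℂ, L.lattice.mkQ t = q v →
    ∃ F : Coord → ℂ, AnalyticAt ℂ F v ∧ F v = t ∧
      ∀ᶠ w in 𝓝 v, w ∈ cone f → L.lattice.mkQ (F w) = q w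

/-- Near `s`, the analytic curve `γ` runs in the cone over `f = 0`, and `T` is an analytic lift to
`ℂ` of its image in the torus. -/
structure IsTorusCoordAt (f : Coord → ℂ) (q : Coord → ℂ ⧸ L.lattice) (γ : ℂ → Coord) (T : ℂ → ℂ)
    (s : ℂ) : Prop where
  analytic_curve : AnalyticAt ℂ γ s
  analytic_coord : AnalyticAt ℂ T s
  mem_cone : ∀ᶠ r in 𝓝 s, γ r ∈ cone f
  mkQ_eq : ∀ᶠ r in 𝓝 s, L.lattice.mkQ (T r) = q (γ r)

namespace IsTorusCoordAt

variable {γ : ℂ → Coord} {T : ℂ → ℂ} {s : ℂ}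

lemma eventually (h : IsTorusCoordAt f q γ T s) : ∀ᶠ r in 𝓝 s, IsTorusCoordAt f q γ T r := by
  filter_upwards [h.analytic_curve.eventually_analyticAt, h.analytic_coord.eventually_analyticAt,
    h.mem_cone.eventually_nhds, h.mkQ_eq.eventually_nhds] with r h₁ h₂ h₃ h₄ using ⟨h₁, h₂, h₃, h₄⟩

lemma comp {σ : ℂ → ℂ} {t : ℂ} (h : IsTorusCoordAt f q γ T (σ t)) (hσ : AnalyticAt ℂ σ t) :
    IsTorusCoordAt f q (γ ∘ σ) (T ∘ σ) t :=
  ⟨h.analytic_curve.comp hσ, h.analytic_coord.comp hσ, hσ.continuousAt.eventually h.mem_cone,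
    hσ.continuousAt.eventually h.mkQ_eq⟩

lemma congr_coord {T' : ℂ → ℂ} (h : IsTorusCoordAt f q γ T s) (hT : T =ᶠ[𝓝 s] T') :
    IsTorusCoordAt f q γ T' s :=
  ⟨h.analytic_curve, h.analytic_coord.congr hT, h.mem_cone,
    (hT.and h.mkQ_eq).mono fun _ hr => hr.1 ▸ hr.2⟩

lemma congr_curve {δ : ℂ → Coord} (h : IsTorusCoordAt f q γ T s) (hδ : AnalyticAt ℂ δ s)
    (hδc : ∀ᶠ r in 𝓝 s, δ r ∈ cone f) (hq : ∀ᶠ r in 𝓝 s, q (γ r) = q (δ r)) :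
    IsTorusCoordAt f q δ T s :=
  ⟨hδ, h.analytic_coord, hδc, (h.mkQ_eq.and hq).mono fun _ hr => hr.1.trans hr.2⟩

lemma add_lattice {l : ℂ} (h : IsTorusCoordAt f q γ T s) (hl : l ∈ L.lattice) :
    IsTorusCoordAt f q γ (fun r => T r + l) s := by
  refine ⟨h.analytic_curve, h.analytic_coord.add analyticAt_const, h.mem_cone, ?_⟩
  filter_upwards [h.mkQ_eq] with r hr
  have hl₀ : L.lattice.mkQ l = 0 := (Submodule.Quotient.mk_eq_zero _).2 hl
  rw [map_add, hl₀, add_zero, hr]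

lemma deriv_eq {T' : ℂ → ℂ} (h : IsTorusCoordAt f q γ T s) (h' : IsTorusCoordAt f q γ T' s) :
    deriv T s = deriv T' s := by
  have hdiscrete := (h.analytic_coord.sub h'.analytic_coord).continuousAt.eventually
    (L.compl_lattice_sdiff_singleton_mem_nhds ((T - T') s))
  have hconst : T =ᶠ[𝓝 s] fun r => T' r + (T - T') s := by
    filter_upwards [hdiscrete, h.mkQ_eq, h'.mkQ_eq] with r hr hT hT'
    have hmem : T r - T' r ∈ L.lattice := (Submodule.Quotient.eq _).1 (hT.trans hT'.symm)
    by_contra hne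
    exact hr ⟨hmem, fun heq => hne (by rw [← heq]; simp)⟩
  rw [hconst.deriv_eq, deriv_add_const]

end IsTorusCoordAt

namespace TorusMap

lemma exists_isTorusCoordAt (hq : TorusMap f L A q) {γ : ℂ → Coord} {s t : ℂ}
    (hγ : AnalyticAt ℂ γ s) (hc : ∀ᶠ r in 𝓝 s, γ r ∈ cone f) (ht : L.lattice.mkQ t = q (γ s)) :
    ∃ T, IsTorusCoordAt f q γ T s ∧ T s = t := by
  obtain ⟨F, hF, hFt, hFq⟩ := hq.exists_lift _ hc.self_of_nhds t ht
  refine ⟨F ∘ γ, ⟨hγ, hF.comp hγ, hc, ?_⟩, hFt⟩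
  filter_upwards [hc, hγ.continuousAt.eventually hFq] with r hr hFr using hFr hr

lemma exists_eventually_samePoint [Finite ι] (hq : TorusMap f L A q) {γ δ : ℂ → Coord} {s : ℂ}
    (hγ : AnalyticAt ℂ γ s) (hδ : AnalyticAt ℂ δ s) (hγc : ∀ᶠ r in 𝓝 s, γ r ∈ cone f)
    (hδc : ∀ᶠ r in 𝓝 s, δ r ∈ cone f) (he : ∀ᶠ r in 𝓝 s, q (γ r) = q (δ r)) :
    ∃ i, ∀ᶠ r in 𝓝 s, SamePoint (diagL (A i).1 (γ r)) (δ r) := by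
  have hex : ∀ᶠ r in 𝓝 s, ∃ i, SamePoint (diagL (A i).1 (γ r)) (δ r) := by
    filter_upwards [hγc, hδc, he] with r h₁ h₂ h₃ using hq.exists_samePoint _ h₁ _ h₂ h₃
  obtain ⟨i, hi⟩ : ∃ i, ∃ᶠ r in 𝓝[≠] s, SamePoint (diagL (A i).1 (γ r)) (δ r) := by
    by_contra! hnot
    obtain ⟨r, ⟨i, hi⟩, hr⟩ :=
      ((hex.filter_mono nhdsWithin_le_nhds).and (eventually_all.2 hnot)).exists
    exact hr i hi
  have hA : AnalyticAt ℂ (fun r => diagL (A i).1 (γ r)) s :=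
    ((diagL (A i).1).analyticAt _).comp hγ
  refine ⟨i, Eventually.and ?_ ?_⟩
  · exact (analyticAt_area (analyticAt_fst.fun_comp hA)
      (analyticAt_fst.fun_comp hδ)).frequently_zero_iff_eventually_zero.1 (hi.mono fun r hr => hr.1)
  · exact (analyticAt_area (analyticAt_snd.fun_comp hA)
      (analyticAt_snd.fun_comp hδ)).frequently_zero_iff_eventually_zero.1 (hi.mono fun r hr => hr.2)

lemma not_eventually_const [Finite ι] (hq : TorusMap f L A q) {γ : ℂ → Coord} {T : ℂ → ℂ} {s : ℂ}
    (h : IsTorusCoordAt f q γ T s) (him : IsImmersed (γ s) (deriv γ s)) :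
    ¬ ∀ᶠ r in 𝓝 s, T r = T s := by
  intro hconst
  have hs := h.mem_cone.self_of_nhds
  have hqconst : ∀ᶠ r in 𝓝 s, q (γ s) = q (γ r) := by
    filter_upwards [hconst, h.mkQ_eq] with r hr hqr
    rw [← hqr, hr, h.mkQ_eq.self_of_nhds]
  obtain ⟨i, hi⟩ := hq.exists_eventually_samePoint analyticAt_const h.analytic_curve
    (Eventually.of_forall fun _ => hs) h.mem_cone hqconst
  exact not_isImmersed_of_sameTangent_zero (sameTangent_of_eventually_samePoint
    (hasDerivAt_const s _) h.analytic_curve.differentiableAt.hasDerivAt hi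
    (mulVec_ne_zero _ hs.1) (mulVec_ne_zero _ hs.2.1)) him

lemma exists_immersed_coord [Finite ι] (hq : TorusMap f L A q) {k : ℕ} (hf : SmoothEquation f k)
    {v : Coord} (hv : v ∈ cone f) {t : ℂ} (ht : L.lattice.mkQ t = q v) :
    ∃ γ T, IsTorusCoordAt f q γ T 0 ∧ γ 0 = v ∧ T 0 = t ∧ IsImmersed v (deriv γ 0) ∧
      ¬ ∀ᶠ s in 𝓝 0, T s = T 0 := by
  obtain ⟨γ, hγ, rfl, hc, him⟩ := hf.exists_param hv
  obtain ⟨T, hT, hT₀⟩ := hq.exists_isTorusCoordAt hγ hc ht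
  exact ⟨γ, T, hT, rfl, hT₀, him, hq.not_eventually_const hT him⟩

end TorusMap

end TorusMaps

section ResidueForms

/-- The linear form `w ↦ (x ∧ x') (y ∧ w₂) - (y ∧ y') (x ∧ w₁)`, which is proportional to the
differential of the equation of any curve through `v = (x, y)` with velocity `v' = (x', y')`. -/
def bracket (v v' w : Coord) : ℂ := area v.1 v'.1 * area v.2 w.2 - area v.2 v'.2 * area v.1 w.1

/-- The residue form defined by `h` on the curve `f = 0` takes the value `c` at the velocity `v'`:
this is the form `h x∧dx / (∂f / ∂y)`, with denominators cleared. -/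
def IsRatio (f h : Coord → ℂ) (v v' : Coord) (c : ℂ) : Prop :=
  ∀ w, c * fderiv ℂ f v w = h v * bracket v v' w

variable {f h : Coord → ℂ} {v v' : Coord} {c : ℂ} {k m : ℕ}

namespace IsRatio

lemma unique {c' : ℂ} (hf : fderiv ℂ f v ≠ 0) (hc : IsRatio f h v v' c)
    (hc' : IsRatio f h v v' c') : c = c' := by
  obtain ⟨w, hw⟩ := DFunLike.ne_iff.1 hf
  exact mul_right_cancel₀ hw ((hc w).trans (hc' w).symm)

lemma smul (hc : IsRatio f h v v' c) (a : ℂ) : IsRatio f h v (a • v') (a * c) := by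
  intro w
  rw [mul_assoc, hc w]
  simp only [bracket, Prod.smul_fst, Prod.smul_snd, area_smul_right]
  ring

lemma add_mul {h₂ : Coord → ℂ} {c₂ : ℂ} (hc : IsRatio f h v v' c) (hc₂ : IsRatio f h₂ v v' c₂)
    (a b : ℂ) : IsRatio f (fun v => a * h v + b * h₂ v) v v' (a * c + b * c₂) := by
  intro w
  linear_combination a * hc w + b * hc₂ w

lemma of_diagL {B : SpecialLinearGroup (Fin 2) ℂ} (hf : Differentiable ℂ f)
    (hfB : ∀ v, f (diagL B.1 v) = f v) (hhB : ∀ v, h (diagL B.1 v) = h v)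
    (hc : IsRatio f h (diagL B.1 v) (diagL B.1 v') c) : IsRatio f h v v' c := by
  intro w
  have hw := hc (diagL B.1 w)
  rw [fderiv_apply_of_semiinvariant hf (diagL B.1) 1 (by simpa only [one_mul]), one_mul, hhB] at hw
  simpa only [bracket, diagL_apply, area_mulVec] using hw

lemma of_sameTangent {u u' : Coord} (hf : IsEntireForm f (m + 2)) (hh : IsEntireForm h m)
    (hu : u ∈ cone f) (ht : SameTangent v v' u u') (hc : IsRatio f h u u' c) :
    IsRatio f h v v' c := by
  obtain ⟨a, b, rfl, h₁, h₂⟩ := ht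
  have ha : a ≠ 0 := fun h0 => hu.1 (by simp [h0])
  have hb : b ≠ 0 := fun h0 => hu.2.1 (by simp [h0])
  intro w
  have hbracket : bracket (scaleL a b v) u' (scaleL a b w) = a ^ 2 * b ^ 2 * bracket v v' w := by
    simp only [bracket, h₁, h₂]
    simp only [scaleL_apply, area_smul_left, area_smul_right]
    ring
  have hw := hc (scaleL a b w)
  rw [hf.fderiv_scaleL, hh.map_scaleL, hbracket] at hw
  refine mul_left_cancel₀ (mul_ne_zero (pow_ne_zero (m + 2) ha) (pow_ne_zero (m + 2) hb)) ?_
  linear_combination hw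

lemma eq_zero_of_immersed (hv : v ∈ cone f) (him : IsImmersed v v') (hc : IsRatio f h v v' 0) :
    h v = 0 := by
  have hzero (x : Fin 2 → ℂ) : area x 0 = 0 := by simp [area]
  obtain ⟨x, hx⟩ := exists_area_eq_one hv.1
  obtain ⟨y, hy⟩ := exists_area_eq_one hv.2.1
  rcases him with him | him
  · simpa [bracket, hy, hzero, him] using hc (0, y)
  · simpa [bracket, hx, hzero, him] using hc (x, 0)

end IsRatio

lemma IsEntireForm.bracket_mul_fderiv (hf : IsEntireForm f k) (hv : v ∈ cone f)
    (ht : fderiv ℂ f v v' = 0) (w w₀ : Coord) :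
    bracket v v' w * fderiv ℂ f v w₀ = bracket v v' w₀ * fderiv ℂ f v w := by
  obtain ⟨x, hx⟩ := exists_area_eq_one hv.1
  obtain ⟨y, hy⟩ := exists_area_eq_one hv.2.1
  simp only [hf.fderiv_apply_eq hv.2.2 hx hy v'] at ht
  rw [hf.fderiv_apply_eq hv.2.2 hx hy w, hf.fderiv_apply_eq hv.2.2 hx hy w₀, bracket, bracket]
  linear_combination (area v.1 w₀.1 * area v.2 w.2 - area v.1 w.1 * area v.2 w₀.2) * ht

lemma fderiv_deriv_eq_zero {γ : ℂ → Coord} {s : ℂ} (hf : DifferentiableAt ℂ f (γ s))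
    (hγ : DifferentiableAt ℂ γ s) (hc : ∀ᶠ r in 𝓝 s, f (γ r) = 0) :
    fderiv ℂ f (γ s) (deriv γ s) = 0 :=
  (hf.hasFDerivAt.comp_hasDerivAt s hγ.hasDerivAt).unique
    ((hasDerivAt_const s (0 : ℂ)).congr_of_eventuallyEq hc)

lemma SmoothEquation.exists_isRatio (hf : SmoothEquation f k) (hh : ∀ v, AnalyticAt ℂ h v)
    {γ : ℂ → Coord} {s : ℂ} (hγ : AnalyticAt ℂ γ s) (hc : ∀ᶠ r in 𝓝 s, γ r ∈ cone f) :
    ∃ c : ℂ → ℂ, AnalyticAt ℂ c s ∧ ∀ᶠ r in 𝓝 s, IsRatio f h (γ r) (deriv γ r) (c r) := by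
  obtain ⟨w₀, hw₀⟩ := DFunLike.ne_iff.1 (hf.fderiv_ne_zero _ hc.self_of_nhds)
  have hD : AnalyticAt ℂ (fun r => fderiv ℂ f (γ r) w₀) s :=
    ((ContinuousLinearMap.apply ℂ ℂ w₀).analyticAt _).comp ((hf.analytic _).fderiv.comp hγ)
  have hbracket : AnalyticAt ℂ (fun r => bracket (γ r) (deriv γ r) w₀) s := by
    have h₁ := analyticAt_fst.fun_comp hγ
    have h₂ := analyticAt_snd.fun_comp hγ
    exact ((analyticAt_area h₁ (analyticAt_fst.fun_comp hγ.deriv)).mul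
      (analyticAt_area h₂ analyticAt_const)).sub
      ((analyticAt_area h₂ (analyticAt_snd.fun_comp hγ.deriv)).mul
      (analyticAt_area h₁ analyticAt_const))
  refine ⟨_, (((hh _).fun_comp hγ).mul hbracket).div hD hw₀, ?_⟩
  filter_upwards [hc, hc.eventually_nhds, hγ.eventually_analyticAt,
    hD.continuousAt.eventually_ne hw₀] with r hr hr' hγr hw w
  have ht := fderiv_deriv_eq_zero (hf.differentiable _) hγr.differentiableAt
    (hr'.mono fun _ hs => hs.2.2)
  have hbw := hf.bracket_mul_fderiv hr ht w w₀
  simp only [Pi.div_apply, Pi.mul_apply]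
  rw [div_mul_eq_mul_div, div_eq_iff hw]
  linear_combination -h (γ r) * hbw

end ResidueForms

section InvariantForms

/-- Invariance of a function under the diagonal action of the matrices `A i`. -/
def IsInvariant {ι : Type*} (A : ι → SpecialLinearGroup (Fin 2) ℂ) (h : Coord → ℂ) : Prop :=
  ∀ i v, h (diagL (A i).1 v) = h v

variable {ι : Type*} {f h : Coord → ℂ} {L : PeriodPair} {k m : ℕ}
  {A : ι → SpecialLinearGroup (Fin 2) ℂ} {q : Coord → ℂ ⧸ L.lattice} {t c : ℂ}

/-- The residue form defined by `h`, transported to the torus, is `c dt` at `t`. -/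
def TorusRatio (f h : Coord → ℂ) {L : PeriodPair} (q : Coord → ℂ ⧸ L.lattice) (t c : ℂ) : Prop :=
  ∃ γ, IsTorusCoordAt f q γ id t ∧ IsRatio f h (γ t) (deriv γ t) c

namespace TorusRatio

lemma unique [Finite ι] (hf : SmoothEquation f (m + 2)) (hh : IsEntireForm h m)
    (hq : TorusMap f L A q) (hfA : IsInvariant A f) (hhA : IsInvariant A h) {c' : ℂ}
    (hc : TorusRatio f h q t c) (hc' : TorusRatio f h q t c') : c = c' := by
  obtain ⟨γ, hγ, hr⟩ := hc
  obtain ⟨δ, hδ, hr'⟩ := hc'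
  obtain ⟨i, hi⟩ := hq.exists_eventually_samePoint hγ.analytic_curve hδ.analytic_curve hγ.mem_cone
    hδ.mem_cone ((hγ.mkQ_eq.and hδ.mkQ_eq).mono fun _ hs => hs.1.symm.trans hs.2)
  have hv := hγ.mem_cone.self_of_nhds
  have hAγ : HasDerivAt (fun s => diagL (A i).1 (γ s)) (diagL (A i).1 (deriv γ t)) t :=
    (diagL (A i).1).hasFDerivAt.comp_hasDerivAt t hγ.analytic_curve.differentiableAt.hasDerivAt
  have htan := sameTangent_of_eventually_samePoint hAγ
    hδ.analytic_curve.differentiableAt.hasDerivAt hi (mulVec_ne_zero _ hv.1)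
    (mulVec_ne_zero _ hv.2.1)
  exact hr.unique (hf.fderiv_ne_zero _ hv) ((hr'.of_sameTangent hf.toIsEntireForm hh
    hδ.mem_cone.self_of_nhds htan).of_diagL hf.differentiable (hfA i) (hhA i))

lemma of_deriv_ne_zero {γ : ℂ → Coord} {T : ℂ → ℂ} {s : ℂ} (hT : IsTorusCoordAt f q γ T s)
    (hd : deriv T s ≠ 0) (hr : IsRatio f h (γ s) (deriv γ s) c) :
    TorusRatio f h q (T s) (c / deriv T s) := by
  obtain ⟨σ, hσ, hσs, hσT⟩ := exists_analytic_right_inverse hT.analytic_coord hd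
  have hT' : IsTorusCoordAt f q γ T (σ (T s)) := by rwa [hσs]
  have hderivσ : deriv σ (T s) = (deriv T s)⁻¹ := by
    have hcomp := (hT'.analytic_coord.differentiableAt.hasDerivAt.comp (T s)
      hσ.differentiableAt.hasDerivAt).unique ((hasDerivAt_id (T s)).congr_of_eventuallyEq hσT)
    rw [hσs] at hcomp
    exact eq_inv_of_mul_eq_one_right hcomp
  have hderiv : deriv (γ ∘ σ) (T s) = (deriv T s)⁻¹ • deriv γ s := by
    rw [deriv.scomp (T s) hT'.analytic_curve.differentiableAt hσ.differentiableAt, hderivσ, hσs]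
  refine ⟨γ ∘ σ, (hT'.comp hσ).congr_coord hσT, ?_⟩
  rw [hderiv, Function.comp_apply, hσs, div_eq_inv_mul]
  exact hr.smul _

lemma add_lattice {l : ℂ} (hl : l ∈ L.lattice) (hc : TorusRatio f h q t c) :
    TorusRatio f h q (t + l) c := by
  obtain ⟨γ, hγ, hr⟩ := hc
  have htl : t + l - l = t := add_sub_cancel_right t l
  have hγ' : IsTorusCoordAt f q γ id (t + l - l) := by rwa [htl]
  refine ⟨fun s => γ (s - l), ?_, ?_⟩
  · exact ((hγ'.comp (σ := fun s => s - l) (analyticAt_id.sub analyticAt_const)).add_lattice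
      hl).congr_coord (Eventually.of_forall fun s => sub_add_cancel s l)
  · simpa only [deriv_comp_sub_const, htl] using hr

lemma eventually_exists (hf : SmoothEquation f k) (hh : ∀ v, AnalyticAt ℂ h v)
    (hc : TorusRatio f h q t c) :
    ∃ c : ℂ → ℂ, AnalyticAt ℂ c t ∧ ∀ᶠ s in 𝓝 t, TorusRatio f h q s (c s) := by
  obtain ⟨γ, hγ, -⟩ := hc
  obtain ⟨c, hc, hr⟩ := hf.exists_isRatio hh hγ.analytic_curve hγ.mem_cone
  exact ⟨c, hc, (hγ.eventually.and hr).mono fun s hs => ⟨γ, hs⟩⟩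

lemma eventually_of_isRatio {γ : ℂ → Coord} {T c : ℂ → ℂ} {s₀ : ℂ} (hT : IsTorusCoordAt f q γ T s₀)
    (hne : ¬ ∀ᶠ s in 𝓝 s₀, T s = T s₀) (hr : ∀ᶠ s in 𝓝 s₀, IsRatio f h (γ s) (deriv γ s) (c s)) :
    ∀ᶠ s in 𝓝[≠] s₀, deriv T s ≠ 0 ∧ TorusRatio f h q (T s) (c s / deriv T s) := by
  filter_upwards [eventually_deriv_ne_zero hT.analytic_coord hne,
    nhdsWithin_le_nhds hT.eventually, nhdsWithin_le_nhds hr] with s h₁ h₂ h₃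
    using ⟨h₁, .of_deriv_ne_zero h₂ h₁ h₃⟩

end TorusRatio

/-- The coefficient of `dt` in the residue form defined by `h`, transported to the torus. -/
def formRatio (f h : Coord → ℂ) {L : PeriodPair} (q : Coord → ℂ ⧸ L.lattice) (t : ℂ) : ℂ :=
  Classical.epsilon (TorusRatio f h q t)

lemma formRatio_add_lattice {l : ℂ} (hl : l ∈ L.lattice) :
    formRatio f h q (t + l) = formRatio f h q t := by
  refine congrArg Classical.epsilon (funext fun c => propext ⟨fun hc => ?_, fun hc => ?_⟩)
  · simpa using hc.add_lattice (neg_mem hl)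
  · exact hc.add_lattice hl

variable [Finite ι]

lemma TorusRatio.formRatio_eq (hf : SmoothEquation f (m + 2)) (hh : IsEntireForm h m)
    (hq : TorusMap f L A q) (hfA : IsInvariant A f) (hhA : IsInvariant A h)
    (hc : TorusRatio f h q t c) : formRatio f h q t = c :=
  (Classical.epsilon_spec ⟨c, hc⟩).unique hf hh hq hfA hhA hc

lemma TorusRatio.analyticAt_formRatio (hf : SmoothEquation f (m + 2)) (hh : IsEntireForm h m)
    (hq : TorusMap f L A q) (hfA : IsInvariant A f) (hhA : IsInvariant A h)
    (hc : TorusRatio f h q t c) : AnalyticAt ℂ (formRatio f h q) t := by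
  obtain ⟨c, hc, hr⟩ := hc.eventually_exists hf hh.analytic
  exact hc.congr (hr.mono fun s hs => (hs.formRatio_eq hf hh hq hfA hhA).symm)

lemma TorusMap.exists_torusRatio_eq_const (hf : SmoothEquation f (m + 2)) (hh : IsEntireForm h m)
    (hq : TorusMap f L A q) (hfA : IsInvariant A f) (hhA : IsInvariant A h) :
    ∃ c₀, ∀ t c, TorusRatio f h q t c → c = c₀ := by
  have hanalytic t c (hc : TorusRatio f h q t c) := hc.analyticAt_formRatio hf hh hq hfA hhA
  have hlocal t₀ : (∀ᶠ t in 𝓝[≠] t₀, AnalyticAt ℂ (formRatio f h q) t) ∧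
      Tendsto (fun t => (t - t₀) * formRatio f h q t) (𝓝[≠] t₀) (𝓝 0) := by
    obtain ⟨v, hv, ht⟩ := hq.exists_eq t₀
    obtain ⟨γ, T, hT, rfl, rfl, -, hne⟩ := hq.exists_immersed_coord hf hv ht
    obtain ⟨c, hc, hr⟩ := hf.exists_isRatio hh.analytic hT.analytic_curve hT.mem_cone
    have hratio := TorusRatio.eventually_of_isRatio hT hne hr
    have hle : 𝓝[≠] (T 0) ≤ map T (𝓝[≠] 0) := punctured_nhds_le_map
      (hT.analytic_coord.eventually_constant_or_nhds_le_map_nhds.resolve_left hne)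
    refine ⟨hle (hratio.mono fun s hs => hanalytic _ _ hs.2), Tendsto.mono_left ?_ hle⟩
    have hlim := (tendsto_sub_div_deriv hT.analytic_coord).mul
      (hc.continuousAt.tendsto.mono_left nhdsWithin_le_nhds)
    rw [zero_mul] at hlim
    refine tendsto_map'_iff.2 (hlim.congr' ?_)
    filter_upwards [hratio] with s ⟨_, hs⟩
    rw [Function.comp_apply, hs.formRatio_eq hf hh hq hfA hhA, div_mul_eq_mul_div, mul_div_assoc]
  obtain ⟨c₀, hc₀⟩ := exists_const_of_lattice_periodic L
    (fun t l hl => formRatio_add_lattice hl) (fun t₀ => (hlocal t₀).1) fun t₀ => (hlocal t₀).2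
  exact ⟨c₀, fun t c hc => by
    rw [← hc₀ t (hanalytic t c hc).continuousAt, hc.formRatio_eq hf hh hq hfA hhA]⟩

lemma TorusMap.eq_zero_of_torusRatio_eq_zero (hf : SmoothEquation f k)
    (hh : ∀ v, AnalyticAt ℂ h v) (hq : TorusMap f L A q)
    (h0 : ∀ t c, TorusRatio f h q t c → c = 0) {v : Coord} (hv : v ∈ cone f) : h v = 0 := by
  obtain ⟨t, ht⟩ := L.lattice.mkQ_surjective (q v)
  obtain ⟨γ, T, hT, rfl, -, him, hne⟩ := hq.exists_immersed_coord hf hv ht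
  obtain ⟨c, hc, hr⟩ := hf.exists_isRatio hh hT.analytic_curve hT.mem_cone
  have hzero : ∀ᶠ s in 𝓝[≠] 0, c s = 0 := by
    filter_upwards [TorusRatio.eventually_of_isRatio hT hne hr] with s ⟨hd, hs⟩
    exact (div_eq_zero_iff.1 (h0 _ _ hs)).resolve_right hd
  have hc₀ : c 0 = 0 := (hc.frequently_zero_iff_eventually_zero.1 hzero.frequently).self_of_nhds
  exact IsRatio.eq_zero_of_immersed hv him (by simpa only [hc₀] using hr.self_of_nhds)

theorem TorusMap.exists_linear_relation {h₁ h₂ : Coord → ℂ} (hf : SmoothEquation f (m + 2))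
    (hq : TorusMap f L A q) (hfA : IsInvariant A f) (hh₁ : IsEntireForm h₁ m)
    (hA₁ : IsInvariant A h₁) (hh₂ : IsEntireForm h₂ m) (hA₂ : IsInvariant A h₂) :
    ∃ a b : ℂ, (a ≠ 0 ∨ b ≠ 0) ∧ ∀ v ∈ cone f, a * h₁ v + b * h₂ v = 0 := by
  obtain ⟨c₁, hc₁⟩ := hq.exists_torusRatio_eq_const hf hh₁ hfA hA₁
  obtain ⟨c₂, hc₂⟩ := hq.exists_torusRatio_eq_const hf hh₂ hfA hA₂
  have hvanish a b (hab : a * c₁ + b * c₂ = 0) v (hv : v ∈ cone f) : a * h₁ v + b * h₂ v = 0 := by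
    refine hq.eq_zero_of_torusRatio_eq_zero (h := fun v => a * h₁ v + b * h₂ v) hf
      (fun v => (analyticAt_const.mul (hh₁.analytic v)).add
        (analyticAt_const.mul (hh₂.analytic v))) ?_ hv
    rintro t c ⟨γ, hγ, hr⟩
    obtain ⟨d₁, -, hd₁⟩ := hf.exists_isRatio hh₁.analytic hγ.analytic_curve hγ.mem_cone
    obtain ⟨d₂, -, hd₂⟩ := hf.exists_isRatio hh₂.analytic hγ.analytic_curve hγ.mem_cone
    have hsum := hr.unique (hf.fderiv_ne_zero _ hγ.mem_cone.self_of_nhds)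
      (hd₁.self_of_nhds.add_mul hd₂.self_of_nhds a b)
    rw [hsum, hc₁ _ _ ⟨γ, hγ, hd₁.self_of_nhds⟩, hc₂ _ _ ⟨γ, hγ, hd₂.self_of_nhds⟩, hab]
  by_cases h0 : c₁ = 0
  · exact ⟨1, 0, Or.inl one_ne_zero, hvanish 1 0 (by simp [h0])⟩
  · exact ⟨c₂, -c₁, Or.inr (neg_ne_zero.2 h0), hvanish _ _ (by ring)⟩

end InvariantForms

section DegreeOne

variable {ι : Type*} {f : Coord → ℂ} {L : PeriodPair} {A : ι → SpecialLinearGroup (Fin 2) ℂ}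
  {q : Coord → ℂ ⧸ L.lattice}

lemma TorusMap.exists_entire_deriv (hq : TorusMap f L A q) {γ : ℂ → Coord}
    (hγ : ∀ s, AnalyticAt ℂ γ s) (hc : ∀ s, γ s ∈ cone f) :
    ∃ D : ℂ → ℂ, Differentiable ℂ D ∧ (∀ s, ∃ T, IsTorusCoordAt f q γ T s) ∧
      ∀ s T, IsTorusCoordAt f q γ T s → deriv T s = D s := by
  have hex s : ∃ T, IsTorusCoordAt f q γ T s := by
    obtain ⟨t, ht⟩ := L.lattice.mkQ_surjective (q (γ s))
    obtain ⟨T, hT, -⟩ := hq.exists_isTorusCoordAt (hγ s) (Eventually.of_forall hc) ht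
    exact ⟨T, hT⟩
  choose T hT using hex
  have hD s T' (h : IsTorusCoordAt f q γ T' s) : deriv T' s = deriv (T s) s := h.deriv_eq (hT s)
  refine ⟨fun s => deriv (T s) s, fun s => ?_, fun s => ⟨T s, hT s⟩, hD⟩
  exact ((hT s).analytic_coord.deriv.congr
    ((hT s).eventually.mono fun r hr => hD r _ hr)).differentiableAt

lemma TorusMap.false_of_rational [Finite ι] (hq : TorusMap f L A q) {γ δ : ℂ → Coord}
    (hγ : ∀ s, AnalyticAt ℂ γ s) (hδ : ∀ s, AnalyticAt ℂ δ s) (hγc : ∀ s, γ s ∈ cone f)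
    (hδc : ∀ s, δ s ∈ cone f) (h : ∀ s, s ≠ 0 → δ s = s • γ s⁻¹)
    (him : IsImmersed (γ 0) (deriv γ 0)) : False := by
  obtain ⟨D, hD, hex, hDT⟩ := hq.exists_entire_deriv hγ hγc
  obtain ⟨D', hD', -, hDT'⟩ := hq.exists_entire_deriv hδ hδc
  have hrel s (hs : s ≠ 0) : D s = -(s⁻¹ ^ 2 * D' s⁻¹) := by
    obtain ⟨T, hT⟩ := hex s
    have hTinv : IsTorusCoordAt f q γ T s⁻¹⁻¹ := by rwa [inv_inv]
    have hTδ : IsTorusCoordAt f q δ (T ∘ Inv.inv) s⁻¹ := by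
      refine (hTinv.comp (analyticAt_inv (inv_ne_zero hs))).congr_curve (hδ _)
        (Eventually.of_forall hδc) ?_
      filter_upwards [eventually_ne_nhds (inv_ne_zero hs)] with r hr
      rw [h r hr, hq.map_smul _ (hγc _) r hr, Function.comp_apply]
    have hderiv := hTinv.analytic_coord.differentiableAt.hasDerivAt.comp s⁻¹
      (hasDerivAt_inv (inv_ne_zero hs))
    rw [← hDT' _ _ hTδ, hderiv.deriv, inv_inv, hDT s T hT]
    field_simp
  obtain ⟨T, hT⟩ := hex 0
  obtain ⟨s, hs, hTs⟩ := ((eventually_deriv_ne_zero hT.analytic_coord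
    (hq.not_eventually_const hT him)).and (nhdsWithin_le_nhds hT.eventually)).exists
  exact hs ((hDT s T hTs).trans (eq_zero_of_entire_differential hD hD' hrel s))

lemma TorusMap.false_of_linear [Finite ι] (hq : TorusMap f L A q)
    (n : (Fin 2 → ℂ) →L[ℂ] (Fin 2 → ℂ)) (hn : ∀ x, x ≠ 0 → (x, n x) ∈ cone f) : False := by
  have hγ₁ s : HasDerivAt (fun s : ℂ => ![1, s]) ![0, 1] s :=
    hasDerivAt_pi.2 fun i => by
      fin_cases i
      · exact hasDerivAt_const s 1
      · exact hasDerivAt_id s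
  have hcoord {x : ℂ → Fin 2 → ℂ} (hx : ∀ s i, AnalyticAt ℂ (x · i) s) s :
      AnalyticAt ℂ (fun s => (x s, n (x s))) s :=
    have hxs := analyticAt_pi_iff.2 (hx s)
    hxs.prod ((n.analyticAt _).comp hxs)
  have hγ := hcoord (x := fun s => ![1, s]) fun s i => by
    fin_cases i
    · exact analyticAt_const
    · exact analyticAt_id
  have hδ := hcoord (x := fun s => ![s, 1]) fun s i => by
    fin_cases i
    · exact analyticAt_id
    · exact analyticAt_const
  refine hq.false_of_rational hγ hδ (fun s => hn _ ?_) (fun s => hn _ ?_) (fun s hs => ?_)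
    (Or.inl ?_)
  · exact fun h => one_ne_zero (congrFun h 0)
  · exact fun h => one_ne_zero (congrFun h 1)
  · have hsmul : ![s, 1] = s • ![1, s⁻¹] := by simp [hs]
    rw [Prod.smul_mk, ← n.map_smul, ← hsmul]
  · have hderiv : HasDerivAt (fun s : ℂ => (![1, s], n ![1, s])) (![0, 1], n ![0, 1]) 0 :=
      (hγ₁ 0).prodMk (n.hasFDerivAt.comp_hasDerivAt 0 (hγ₁ 0))
    rw [hderiv.deriv]
    simp [area]

variable {k : ℕ}

lemma IsEntireForm.apply_eq_fderiv_left (hf : IsEntireForm f 1) (x y : Fin 2 → ℂ) :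
    f (x, y) = fderiv ℂ f (0, y) (x, 0) := by
  refine (fderiv_apply_eq_of_forall_line (b := 0) (hf.differentiable _) fun s => ?_).symm
  simpa using hf.map_scaleL s 1 (x, y)

lemma IsEntireForm.apply_eq_fderiv_right (hf : IsEntireForm f 1) (x y : Fin 2 → ℂ) :
    f (x, y) = fderiv ℂ f (x, 0) (0, y) := by
  refine (fderiv_apply_eq_of_forall_line (b := 0) (hf.differentiable _) fun s => ?_).symm
  simpa using hf.map_scaleL 1 s (x, y)

lemma IsEntireForm.exists_eq_area (hf : IsEntireForm f 1) :
    ∃ n : (Fin 2 → ℂ) →L[ℂ] (Fin 2 → ℂ), ∀ x y, f (x, y) = area (n x) y := by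
  let g (i : Fin 2) : (Fin 2 → ℂ) →L[ℂ] ℂ :=
    (fderiv ℂ f (0, Pi.single i 1)).comp (ContinuousLinearMap.inl ℂ _ _)
  have hg i x : g i x = f (x, Pi.single i 1) := (hf.apply_eq_fderiv_left x _).symm
  refine ⟨ContinuousLinearMap.pi ![g 1, -g 0], fun x y => ?_⟩
  have hy : ((0, y) : Coord) = y 0 • (0, Pi.single 0 1) + y 1 • (0, Pi.single 1 1) := by
    ext i
    · simp
    · fin_cases i <;> simp
  rw [hf.apply_eq_fderiv_right, hy, map_add, map_smul, map_smul, ← hf.apply_eq_fderiv_right,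
    ← hf.apply_eq_fderiv_right, ← hg, ← hg]
  simp only [area, ContinuousLinearMap.coe_pi', cons_val_zero, cons_val_one, smul_eq_mul,
    _root_.neg_apply]
  ring

lemma SmoothEquation.apply_ne_zero_of_eq_area (hf : SmoothEquation f k)
    {n : (Fin 2 → ℂ) →L[ℂ] (Fin 2 → ℂ)} (hn : ∀ x y, f (x, y) = area (n x) y) {x : Fin 2 → ℂ}
    (hx : x ≠ 0) : n x ≠ 0 := by
  intro h0
  obtain ⟨z, hz⟩ := exists_area_eq_one hx
  obtain ⟨y, hy, hzy⟩ : ∃ y, y ≠ 0 ∧ area (n z) y = 0 := by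
    by_cases h : n z = 0
    · exact ⟨x, hx, by rw [h, area_zero_left]⟩
    · exact ⟨n z, h, area_self _⟩
  obtain ⟨w, hw⟩ := exists_area_eq_one hy
  have hxy y : f (x, y) = 0 := by rw [hn, h0, area_zero_left]
  have hz₀ : fderiv ℂ f (x, y) (z, 0) = 0 := by
    refine fderiv_apply_eq_of_forall_line (b := 0) (hf.differentiable _) fun s => ?_
    simp [hn, h0, area_smul_left, hzy]
  have hw₀ : fderiv ℂ f (x, y) (0, w) = 0 :=
    fderiv_apply_eq_of_forall_line (b := 0) (hf.differentiable _) fun s => by simp [hxy]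
  refine hf.fderiv_ne_zero _ ⟨hx, hy, hxy y⟩ (ContinuousLinearMap.ext fun u => ?_)
  rw [hf.fderiv_apply_eq (hxy y) hz hw u, hz₀, hw₀]
  simp

theorem TorusMap.false_of_degree_one [Finite ι] (hf : SmoothEquation f 1)
    (hq : TorusMap f L A q) : False := by
  obtain ⟨n, hn⟩ := hf.exists_eq_area
  exact hq.false_of_linear n fun x hx =>
    ⟨hx, hf.apply_ne_zero_of_eq_area hn hx, by rw [hn, area_self]⟩

end DegreeOne

section Forms

section MvPolynomial

variable {σ τ K : Type*} [Field K] [Finite σ]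

lemma isWeightedHomogeneous_aeval {M : Type*} [AddCommMonoid M] {w : σ → M} {w' : τ → M} {m : M}
    {f : MvPolynomial σ K} (hf : f.IsWeightedHomogeneous w m) {g : σ → MvPolynomial τ K}
    (hg : ∀ i, (g i).IsWeightedHomogeneous w' (w i)) :
    (aeval g f).IsWeightedHomogeneous w' m := by
  have := Fintype.ofFinite σ
  rw [aeval_def, eval₂_eq']
  refine IsWeightedHomogeneous.sum _ _ _ fun d hd => ?_
  have hprod := IsWeightedHomogeneous.prod Finset.univ (fun i => g i ^ d i) _
    fun i _ => (hg i).pow (d i)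
  rw [← hf (mem_support_iff.1 hd), Finsupp.weight_apply, Finsupp.sum_fintype _ _ (by simp)]
  exact hprod.C_mul _

lemma exists_dvd_pow_of_eval_eq_zero [IsAlgClosed K] {f g : MvPolynomial σ K}
    (h : ∀ x, eval x f = 0 → eval x g = 0) : ∃ n, f ∣ g ^ n := by
  have hg : g ∈ vanishingIdeal K (MvPolynomial.zeroLocus K (Ideal.span {f})) := by
    refine mem_vanishingIdeal_iff.2 fun x hx => h x ?_
    exact mem_zeroLocus_iff.1 hx f (Ideal.mem_span_singleton_self f)
  rw [vanishingIdeal_zeroLocus_eq_radical] at hg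
  exact hg.imp fun n hn => Ideal.mem_span_singleton.1 hn

end MvPolynomial

/-- Polynomials in the two pairs of homogeneous coordinates. -/
abbrev BiPoly : Type := MvPolynomial (Fin 2 ⊕ Fin 2) ℂ

/-- The function on pairs of homogeneous coordinates defined by a polynomial. -/
def evalC (f : BiPoly) (v : Coord) : ℂ := eval (Sum.elim v.1 v.2) f

lemma evalC_injective {f g : BiPoly} (h : ∀ v, evalC f v = evalC g v) : f = g := by
  refine MvPolynomial.funext fun x => ?_
  simpa only [evalC, Sum.elim_comp_inl_inr] using h (x ∘ Sum.inl, x ∘ Sum.inr)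

@[simp] lemma evalC_mul (f g : BiPoly) (v : Coord) : evalC (f * g) v = evalC f v * evalC g v :=
  map_mul _ _ _

@[simp] lemma evalC_add (f g : BiPoly) (v : Coord) : evalC (f + g) v = evalC f v + evalC g v :=
  map_add _ _ _

@[simp] lemma evalC_pow (f : BiPoly) (n : ℕ) (v : Coord) : evalC (f ^ n) v = evalC f v ^ n :=
  map_pow _ _ _

@[simp] lemma evalC_C (c : ℂ) (v : Coord) : evalC (C c) v = c := eval_C _

lemma evalC_X (i : Fin 2 ⊕ Fin 2) (v : Coord) : evalC (X i) v = Sum.elim v.1 v.2 i := eval_X _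

/-- The substitution of a matrix in both pairs of variables. -/
def act (A : Matrix (Fin 2) (Fin 2) ℂ) : BiPoly →ₐ[ℂ] BiPoly :=
  aeval (Sum.elim (A.map C *ᵥ (X ∘ Sum.inl)) (A.map C *ᵥ (X ∘ Sum.inr)))

@[simp] lemma evalC_act (A : Matrix (Fin 2) (Fin 2) ℂ) (f : BiPoly) (v : Coord) :
    evalC (act A f) v = evalC f (diagL A v) := by
  rw [evalC, act, ← coe_aeval_eq_eval, RingHom.coe_coe, ← AlgHom.comp_apply, comp_aeval, evalC,
    ← coe_aeval_eq_eval, RingHom.coe_coe]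
  refine congrArg (fun x => aeval x f) (funext fun i => ?_)
  rcases i with i | i <;>
    simp [Matrix.mulVec, dotProduct, -Matrix.mulVec_fin_two, -Matrix.cons_mulVec]

lemma act_mul (A B : Matrix (Fin 2) (Fin 2) ℂ) (f : BiPoly) :
    act (A * B) f = act B (act A f) :=
  evalC_injective fun v => by simp only [evalC_act, diagL_apply, Matrix.mulVec_mulVec]

lemma act_one (f : BiPoly) : act 1 f = f :=
  evalC_injective fun v => by simp only [evalC_act, diagL_apply, Matrix.one_mulVec]

lemma act_inv_act (A : Matrix.SpecialLinearGroup (Fin 2) ℂ) (f : BiPoly) :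
    act (A⁻¹).1 (act A.1 f) = f := by
  rw [← act_mul, ← Matrix.SpecialLinearGroup.coe_mul, mul_inv_cancel,
    Matrix.SpecialLinearGroup.coe_one, act_one]

lemma analyticAt_evalC (f : BiPoly) (v : Coord) : AnalyticAt ℂ (evalC f) v := by
  refine AnalyticAt.aeval_mvPolynomial (f := fun v : Coord => Sum.elim v.1 v.2) (fun i => ?_) f
  rcases i with i | i
  · exact ((ContinuousLinearMap.proj i).comp (ContinuousLinearMap.fst ℂ _ _)).analyticAt v
  · exact ((ContinuousLinearMap.proj i).comp (ContinuousLinearMap.snd ℂ _ _)).analyticAt v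

/-- The basis vector of `Coord` dual to a variable. -/
def coordSingle (i : Fin 2 ⊕ Fin 2) : Coord :=
  ((Pi.single i 1 : Fin 2 ⊕ Fin 2 → ℂ) ∘ Sum.inl, (Pi.single i 1 : Fin 2 ⊕ Fin 2 → ℂ) ∘ Sum.inr)

lemma fderiv_evalC_X_coordSingle (v : Coord) (i j : Fin 2 ⊕ Fin 2) :
    fderiv ℂ (evalC (X j)) v (coordSingle i) = evalC (pderiv i (X j)) v := by
  have hpderiv : evalC (pderiv i (X j)) v = evalC (X j) (coordSingle i) := by
    rw [evalC_X, coordSingle, Sum.elim_comp_inl_inr, pderiv_X]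
    obtain rfl | hij := eq_or_ne i j
    · simp [evalC]
    · simp [evalC, hij.symm]
  refine fderiv_apply_eq_of_forall_line (b := evalC (X j) v)
    (analyticAt_evalC _ v).differentiableAt fun s => ?_
  rw [hpderiv]
  rcases j with j | j <;> simp [evalC_X]

lemma fderiv_evalC_coordSingle (f : BiPoly) (v : Coord) (i : Fin 2 ⊕ Fin 2) :
    fderiv ℂ (evalC f) v (coordSingle i) = evalC (pderiv i f) v := by
  have hd (g : BiPoly) : DifferentiableAt ℂ (evalC g) v := (analyticAt_evalC g v).differentiableAt
  induction f using MvPolynomial.induction_on with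
  | C a =>
    have hconst : evalC (C a) = fun _ => a := funext (evalC_C a)
    rw [hconst, fderiv_fun_const, pderiv_C, evalC, map_zero]
    rfl
  | add p q hp hq =>
    have hadd : evalC (p + q) = evalC p + evalC q := funext (evalC_add p q)
    rw [hadd, fderiv_add (hd p) (hd q), _root_.add_apply, hp, hq, map_add, evalC_add]
  | mul_X p j hp =>
    have hmul : evalC (p * X j) = evalC p * evalC (X j) := funext (evalC_mul p (X j))
    rw [hmul, fderiv_mul (hd p) (hd (X j)), Derivation.leibniz, _root_.add_apply,
      _root_.smul_apply, _root_.smul_apply, hp, fderiv_evalC_X_coordSingle, smul_eq_mul,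
      smul_eq_mul, smul_eq_mul, smul_eq_mul, evalC_add, evalC_mul, evalC_mul]

namespace IsBihomogeneous

variable {f g : BiPoly} {m n k : ℕ}

lemma exponent_add_eq (hf : IsBihomogeneous f m n) {d : Fin 2 ⊕ Fin 2 →₀ ℕ} (hd : coeff d f ≠ 0) :
    d (Sum.inl 0) + d (Sum.inl 1) = m ∧ d (Sum.inr 0) + d (Sum.inr 1) = n := by
  have := hf hd
  rw [Finsupp.weight_apply, Finsupp.sum_fintype _ _ (by simp)] at this
  simpa [-nsmul_eq_mul] using this

lemma totalDegree (hf : IsBihomogeneous f m n) (hf₀ : f ≠ 0) : f.totalDegree = m + n := by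
  refine IsHomogeneous.totalDegree (fun d hd => ?_) hf₀
  obtain ⟨h₁, h₂⟩ := hf.exponent_add_eq hd
  rw [Finsupp.weight_apply, Finsupp.sum_fintype _ _ (by simp)]
  simp [Fintype.sum_sum_type, h₁, h₂]

lemma evalC_scaleL (hf : IsBihomogeneous f m n) (a b : ℂ) (v : Coord) :
    evalC f (scaleL a b v) = a ^ m * b ^ n * evalC f v := by
  simp only [evalC, eval_eq', Finset.mul_sum]
  refine Finset.sum_congr rfl fun d hd => ?_
  obtain ⟨h₁, h₂⟩ := hf.exponent_add_eq (mem_support_iff.1 hd)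
  simp only [Fintype.prod_sum_type, Fin.prod_univ_two, Sum.elim_inl, Sum.elim_inr, scaleL_apply,
    Pi.smul_apply, smul_eq_mul, mul_pow, ← h₁, ← h₂, pow_add]
  ring

lemma isEntireForm (hf : IsBihomogeneous f m m) : IsEntireForm (evalC f) m :=
  ⟨analyticAt_evalC f, hf.evalC_scaleL⟩

lemma act (hf : IsBihomogeneous f m n) (A : Matrix (Fin 2) (Fin 2) ℂ) :
    IsBihomogeneous (act A f) m n := by
  refine isWeightedHomogeneous_aeval hf fun i => ?_
  rcases i with i | i
  · exact IsWeightedHomogeneous.sum Finset.univ (fun j => C (A i j) * X (Sum.inl j)) _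
      fun j _ => (isWeightedHomogeneous_X ℂ _ (Sum.inl j)).C_mul _
  · exact IsWeightedHomogeneous.sum Finset.univ (fun j => C (A i j) * X (Sum.inr j)) _
      fun j _ => (isWeightedHomogeneous_X ℂ _ (Sum.inr j)).C_mul _

end IsBihomogeneous

lemma IsEntireForm.apply_eq_zero {h : Coord → ℂ} {m : ℕ} (hh : IsEntireForm h m) (hm : m ≠ 0)
    {v : Coord} (hv : v.1 = 0 ∨ v.2 = 0) : h v = 0 := by
  rcases hv with hv | hv
  · have hfix : scaleL 0 1 v = v := by ext <;> simp [hv]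
    simpa [hm, hfix] using hh.map_scaleL 0 1 v
  · have hfix : scaleL 1 0 v = v := by ext <;> simp [hv]
    simpa [hm, hfix] using hh.map_scaleL 1 0 v

section SmoothEquation

variable {f g : BiPoly} {k m : ℕ}

lemma SmoothEquation.poly_ne_zero (hf : SmoothEquation (evalC f) k) : f ≠ 0 := by
  rintro rfl
  have hzero : evalC 0 = fun _ => 0 := funext fun v => map_zero _
  refine hf.fderiv_ne_zero (1, 1) ⟨one_ne_zero, one_ne_zero, congrFun hzero _⟩ ?_
  rw [hzero, fderiv_fun_const, Pi.zero_apply]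

lemma SmoothEquation.squarefree (hf : SmoothEquation (evalC f) k) : Squarefree f := by
  rw [squarefree_iff_irreducible_sq_not_dvd_of_ne_zero hf.poly_ne_zero]
  rintro p hp ⟨g, hg⟩
  have hzero : ∀ v : Coord, evalC p v = 0 → v.1 = 0 ∨ v.2 = 0 := by
    intro v hv
    by_contra! hne
    refine hf.fderiv_ne_zero v ⟨hne.1, hne.2, by simp [hg, hv]⟩ ?_
    have hd (q : BiPoly) := (analyticAt_evalC q v).differentiableAt
    have hmul : evalC f = evalC p * evalC (p * g) :=
      funext fun v => by rw [hg, mul_assoc]; exact evalC_mul _ _ v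
    refine ContinuousLinearMap.ext fun w => ?_
    simp [hmul, fderiv_mul (hd _) (hd _), hv]
  have hdvd : ∀ i, p ∣ X (Sum.inl i) ∨ p ∣ X (Sum.inr i) := by
    intro i
    obtain ⟨n, hn⟩ := exists_dvd_pow_of_eval_eq_zero (f := p) (g := X (Sum.inl i) * X (Sum.inr i))
      fun x hx => by
        rcases hzero (x ∘ Sum.inl, x ∘ Sum.inr) (by rwa [evalC, Sum.elim_comp_inl_inr]) with h | h
        · simp [show x (Sum.inl i) = 0 from congrFun h i]
        · simp [show x (Sum.inr i) = 0 from congrFun h i]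
    exact hp.prime.dvd_or_dvd (hp.prime.dvd_of_dvd_pow hn)
  have hX : ∀ i j : Fin 2 ⊕ Fin 2, i ≠ j → p ∣ X i → p ∣ X j → False := fun i j hij hi hj =>
    hij (X_dvd_X.1 ((hp.associated_of_dvd X_prime.irreducible hi).symm.dvd.trans hj))
  rcases hdvd 0 with h₀ | h₀ <;> rcases hdvd 1 with h₁ | h₁ <;> exact hX _ _ (by simp) h₀ h₁

lemma SmoothEquation.dvd_of_vanishing (hf : SmoothEquation (evalC f) k)
    (hg : IsBihomogeneous g m m) (hm : m ≠ 0) (h : ∀ v ∈ cone (evalC f), evalC g v = 0) :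
    f ∣ g := by
  obtain ⟨n, hn⟩ := exists_dvd_pow_of_eval_eq_zero (f := f) (g := g) fun x hx => by
    rw [← Sum.elim_comp_inl_inr x] at hx ⊢
    by_cases hx' : x ∘ Sum.inl = 0 ∨ x ∘ Sum.inr = 0
    · exact hg.isEntireForm.apply_eq_zero hm (v := (_, _)) hx'
    · push Not at hx'
      exact h (_, _) ⟨hx'.1, hx'.2, hx⟩
  exact (isRadical_iff_squarefree_of_ne_zero hf.poly_ne_zero).2 hf.squarefree n g hn

end SmoothEquation

namespace IsBihomogeneous

variable {f g : BiPoly} {k m : ℕ}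

lemma eq_zero_of_vanishing (hf : IsBihomogeneous f k k) (hs : SmoothEquation (evalC f) k)
    (hg : IsBihomogeneous g m m) (hm : m ≠ 0) (hmk : m < k)
    (h : ∀ v ∈ cone (evalC f), evalC g v = 0) : g = 0 := by
  by_contra hg₀
  have hle := totalDegree_le_of_dvd_of_isDomain (hs.dvd_of_vanishing hg hm h) hg₀
  rw [hf.totalDegree hs.poly_ne_zero, hg.totalDegree hg₀] at hle
  lia

lemma exists_eq_C_mul_of_vanishing (hf : IsBihomogeneous f k k) (hs : SmoothEquation (evalC f) k)
    (hg : IsBihomogeneous g k k) (hk : k ≠ 0) (h : ∀ v ∈ cone (evalC f), evalC g v = 0) :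
    ∃ c, g = C c * f := by
  obtain ⟨p, rfl⟩ := hs.dvd_of_vanishing hg hk h
  obtain rfl | hp₀ := eq_or_ne p 0
  · exact ⟨0, by simp⟩
  have hf₀ := hs.poly_ne_zero
  have hdeg := totalDegree_mul_of_isDomain hf₀ hp₀
  rw [hf.totalDegree hf₀, hg.totalDegree (mul_ne_zero hf₀ hp₀)] at hdeg
  have hp : p = C (coeff 0 p) := totalDegree_eq_zero_iff_eq_C.1 (by lia)
  exact ⟨coeff 0 p, by rw [← hp, mul_comm]⟩

end IsBihomogeneous

end Forms

section EllipticQuotient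

lemma psl_smul_mk (A : Matrix.SpecialLinearGroup (Fin 2) ℂ) {x : Fin 2 → ℂ} (hx : x ≠ 0) :
    (QuotientGroup.mk A : PSL2) • (Projectivization.mk ℂ x hx) =
      Projectivization.mk ℂ (A.1 *ᵥ x) (mulVec_ne_zero A hx) := rfl

lemma exists_injOn_mkQ (L : PeriodPair) (t : ℂ) : ∃ U ∈ 𝓝 t, Set.InjOn L.lattice.mkQ U := by
  have hsub : Tendsto (fun p : ℂ × ℂ => p.1 - p.2) (𝓝 (t, t)) (𝓝 0) := by
    rw [← sub_self t]
    exact tendsto_fst.sub tendsto_snd |>.mono_left nhds_prod_eq.le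
  have hnhds := hsub (L.compl_lattice_sdiff_singleton_mem_nhds 0)
  rw [nhds_prod_eq, mem_map, mem_prod_same_iff] at hnhds
  obtain ⟨U, hU, hUL⟩ := hnhds
  refine ⟨U, hU, fun s hs r hr hsr => ?_⟩
  by_contra hne
  exact hUL (Set.mk_mem_prod hs hr) ⟨(Submodule.Quotient.eq _).1 hsr, sub_ne_zero.2 hne⟩

lemma exists_section (L : PeriodPair) (t : ℂ) :
    ∃ φ : ℂ ⧸ L.lattice → ℂ, (∀ τ, L.lattice.mkQ (φ τ) = τ) ∧
      ∀ᶠ s in 𝓝 t, φ (L.lattice.mkQ s) = s := by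
  classical
  obtain ⟨U, hU, hinj⟩ := exists_injOn_mkQ L t
  refine ⟨fun τ => if τ ∈ L.lattice.mkQ '' U then Function.invFunOn L.lattice.mkQ U τ
    else Function.surjInv L.lattice.mkQ_surjective τ, fun τ => ?_, ?_⟩
  · dsimp only
    split_ifs with h
    · exact Function.invFunOn_eq h
    · exact Function.surjInv_eq _ τ
  · filter_upwards [hU] with s hs
    rw [if_pos (Set.mem_image_of_mem _ hs)]
    exact hinj.leftInvOn_invFunOn hs

section ConePoint

variable {f : Coord → ℂ} {v w : Coord}

/-- The point of `ℙ¹ × ℙ¹` below a point of the cone. -/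
def conePoint (v : Coord) (hv : v ∈ cone f) : P1 × P1 :=
  (Projectivization.mk ℂ v.1 hv.1, Projectivization.mk ℂ v.2 hv.2.1)

lemma conePoint_eq_iff (hv : v ∈ cone f) (hw : w ∈ cone f) :
    conePoint v hv = conePoint w hw ↔ ∃ a b : ℂ, scaleL a b w = v := by
  simp only [conePoint, Projectivization.mk_eq_mk_iff', scaleL_apply, Prod.ext_iff]
  exact ⟨fun ⟨⟨a, ha⟩, b, hb⟩ => ⟨a, b, ha, hb⟩, fun ⟨a, b, ha, hb⟩ => ⟨⟨a, ha⟩, b, hb⟩⟩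

lemma samePoint_of_smul_conePoint_eq {A : Matrix.SpecialLinearGroup (Fin 2) ℂ} (hv : v ∈ cone f)
    (hw : w ∈ cone f) (h : (QuotientGroup.mk A : PSL2) • conePoint v hv = conePoint w hw) :
    SamePoint (diagL A.1 v) w := by
  simp only [conePoint, Prod.smul_mk, Prod.mk.injEq, psl_smul_mk,
    Projectivization.mk_eq_mk_iff'] at h
  obtain ⟨⟨a, ha⟩, b, hb⟩ := h
  simp [SamePoint, ← ha, ← hb, area_smul_left, area_self]

lemma IsEntireForm.scaleL_mem_cone {k : ℕ} (hf : IsEntireForm f k) (hv : v ∈ cone f) {a b : ℂ}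
    (ha : a ≠ 0) (hb : b ≠ 0) : scaleL a b v ∈ cone f :=
  ⟨smul_ne_zero ha hv.1, smul_ne_zero hb hv.2.1, by rw [hf.map_scaleL, hv.2.2, mul_zero]⟩

end ConePoint

namespace IsBihomogeneous

variable {f : BiPoly} {k : ℕ} (hf : IsBihomogeneous f k k)

include hf in
lemma mem_zeroLocus_mk_iff {x y : Fin 2 → ℂ} (hx : x ≠ 0) (hy : y ≠ 0) :
    (Projectivization.mk ℂ x hx, Projectivization.mk ℂ y hy) ∈ PlatonicCurves.zeroLocus f ↔
      evalC f (x, y) = 0 := by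
  obtain ⟨a, ha⟩ := Projectivization.exists_smul_eq_mk_rep ℂ x hx
  obtain ⟨b, hb⟩ := Projectivization.exists_smul_eq_mk_rep ℂ y hy
  have hscale := hf.evalC_scaleL a b (x, y)
  rw [scaleL_apply] at hscale
  simp only [PlatonicCurves.zeroLocus, Set.mem_ofPred_eq, ← ha, ← hb]
  change evalC f ((a : ℂ) • x, (b : ℂ) • y) = 0 ↔ _
  simp [hscale]

/-- The point of the curve below a point of its cone. -/
def toLocus (v : Coord) (hv : v ∈ cone (evalC f)) : PlatonicCurves.zeroLocus f :=
  ⟨conePoint v hv, (hf.mem_zeroLocus_mk_iff hv.1 hv.2.1).2 hv.2.2⟩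

lemma exists_toLocus_eq (p : PlatonicCurves.zeroLocus f) : ∃ v hv, hf.toLocus v hv = p :=
  ⟨(p.1.1.rep, p.1.2.rep), ⟨Projectivization.rep_nonzero _, Projectivization.rep_nonzero _, p.2⟩,
    Subtype.ext (Prod.ext (Projectivization.mk_rep _) (Projectivization.mk_rep _))⟩

lemma toLocus_scaleL {v : Coord} (hv : v ∈ cone (evalC f)) {a b : ℂ}
    (hsv : scaleL a b v ∈ cone (evalC f)) : hf.toLocus (scaleL a b v) hsv = hf.toLocus v hv :=
  Subtype.ext ((conePoint_eq_iff hsv hv).2 ⟨a, b, rfl⟩)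

lemma exists_analyticAt_of_holomorphicAt {φ : PlatonicCurves.zeroLocus f → ℂ} {v : Coord}
    {hv : v ∈ cone (evalC f)}
    (hφ : HolomorphicAt (PlatonicCurves.zeroLocus f) φ (hf.toLocus v hv)) :
    ∃ F : Coord → ℂ, AnalyticAt ℂ F v ∧
      ∀ᶠ w in 𝓝 v, ∀ hw : w ∈ cone (evalC f), φ (hf.toLocus w hw) = F w := by
  obtain ⟨x, y, hx, hy, hxy, F, hF, hFφ⟩ := hφ
  have hxyc : (x, y) ∈ cone (evalC f) :=
    ⟨hx, hy, (hf.mem_zeroLocus_mk_iff hx hy).1 (hxy ▸ (hf.toLocus v hv).2)⟩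
  obtain ⟨a, b, hab⟩ := (conePoint_eq_iff hxyc hv).1 hxy.symm
  have ha : a ≠ 0 := by rintro rfl; exact hx (by simpa using (congrArg Prod.fst hab).symm)
  have hb : b ≠ 0 := by rintro rfl; exact hy (by simpa using (congrArg Prod.snd hab).symm)
  rw [← hab] at hF hFφ
  refine ⟨F ∘ scaleL a b, hF.comp ((scaleL a b).analyticAt v), ?_⟩
  filter_upwards [(scaleL a b).continuous.continuousAt.eventually hFφ] with w hwF hw
  have hsw := hf.isEntireForm.scaleL_mem_cone hw ha hb
  rw [← hf.toLocus_scaleL hw hsw]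
  exact hwF hsw.1 hsw.2.1 (hf.toLocus _ hsw).2

open Classical in
/-- The quotient map of the curve onto the torus, on the cone (and `0` elsewhere). -/
def torusCoord {G : Subgroup PSL2} {L : PeriodPair}
    (e : OrbitSpace G (PlatonicCurves.zeroLocus f) ≃ₜ ℂ ⧸ L.lattice) (v : Coord) : ℂ ⧸ L.lattice :=
  if hv : v ∈ cone (evalC f) then e (Quotient.mk _ (hf.toLocus v hv)) else 0

include hf in
lemma exists_torusMap {G : Subgroup PSL2}
    (hE : HasEllipticQuotient G (PlatonicCurves.zeroLocus f)) :
    ∃ (L : PeriodPair) (q : Coord → ℂ ⧸ L.lattice),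
      TorusMap (evalC f) L (fun g : G => Quotient.out g.1) q := by
  obtain ⟨L, e, he⟩ := hE
  have hq (v : Coord) (hv : v ∈ cone (evalC f)) :
      hf.torusCoord e v = e (Quotient.mk _ (hf.toLocus v hv)) := dif_pos hv
  refine ⟨L, hf.torusCoord e, fun t => ?_, fun v hv a ha => ?_, fun v hv w hw h => ?_,
    fun v hv t ht => ?_⟩
  · obtain ⟨p, hp⟩ := Quotient.exists_rep (e.symm (L.lattice.mkQ t))
    obtain ⟨v, hv, rfl⟩ := hf.exists_toLocus_eq p
    exact ⟨v, hv, by rw [hq v hv, hp, e.apply_symm_apply]⟩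
  · have hsv : scaleL a a v ∈ cone (evalC f) := hf.isEntireForm.scaleL_mem_cone hv ha ha
    rw [hq v hv, ← hf.toLocus_scaleL hv hsv, ← hq _ hsv]
    rfl
  · rw [hq v hv, hq w hw] at h
    obtain ⟨g, hg⟩ := (orbitSetoid G _).symm' (Quotient.exact (e.injective h))
    refine ⟨g, samePoint_of_smul_conePoint_eq hv hw ?_⟩
    rw [QuotientGroup.out_eq']
    exact hg
  · obtain ⟨φ, hφ, hφt⟩ := exists_section L t
    rw [hq v hv] at ht
    have hid : AnalyticAt ℂ (fun s => φ (L.lattice.mkQ s)) t :=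
      analyticAt_id.congr (hφt.mono fun s hs => hs.symm)
    obtain ⟨F, hF, hFφ⟩ :=
      hf.exists_analyticAt_of_holomorphicAt ((he φ (hf.toLocus v hv) t ht.symm).1 hid)
    refine ⟨F, hF, ?_, ?_⟩
    · rw [← hFφ.self_of_nhds hv, ← ht, hφt.self_of_nhds]
    · filter_upwards [hFφ] with w hw hwc
      rw [← hw hwc, hφ, hq w hwc]

end IsBihomogeneous

end EllipticQuotient

section RotationCharacters

section Eigenframe

variable {A B : Matrix.SpecialLinearGroup (Fin 2) ℂ} {l : ℂ} {x y : Fin 2 → ℂ}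

lemma scalar_mulVec {r : ℂ} (x : Fin 2 → ℂ) : Matrix.scalar (Fin 2) r *ᵥ x = r • x := by
  ext i
  simp [Matrix.scalar_apply, Matrix.mulVec_diagonal]

lemma exists_smul_of_mk_eq (h : (QuotientGroup.mk A : PSL2) = QuotientGroup.mk B) :
    ∃ r : ℂ, r ^ 2 = 1 ∧ ∀ x, B.1 *ᵥ x = r • A.1 *ᵥ x := by
  rw [QuotientGroup.eq, Matrix.SpecialLinearGroup.mem_center_iff] at h
  obtain ⟨r, hr, hrA⟩ := h
  refine ⟨r, by simpa using hr, fun x => ?_⟩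
  rw [← Matrix.mulVec_smul, ← scalar_mulVec, hrA, Matrix.mulVec_mulVec,
    ← Matrix.SpecialLinearGroup.coe_mul, mul_inv_cancel_left]

lemma mk_eq_one_of_mulVec_eq_smul {r : ℂ} (h : ∀ x, A.1 *ᵥ x = r • x) :
    (QuotientGroup.mk A : PSL2) = 1 := by
  have hA : Matrix.scalar (Fin 2) r = A.1 :=
    Matrix.ext_of_mulVec_single fun i => by rw [h, scalar_mulVec]
  rw [QuotientGroup.eq_one_iff, Matrix.SpecialLinearGroup.mem_center_iff]
  refine ⟨r, ?_, hA⟩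
  simpa [Matrix.scalar_apply, Matrix.det_diagonal] using (congrArg Matrix.det hA).trans A.2

/-- A basis of eigenvectors `x`, `y` of a unimodular matrix, with eigenvalues `l` and `l⁻¹`. -/
structure IsEigenframe (A : Matrix.SpecialLinearGroup (Fin 2) ℂ) (l : ℂ) (x y : Fin 2 → ℂ) :
    Prop where
  eigenvalue_ne_zero : l ≠ 0
  area_ne_zero : area x y ≠ 0
  mulVec_left : A.1 *ᵥ x = l • x
  mulVec_right : A.1 *ᵥ y = l⁻¹ • y

namespace IsEigenframe

lemma symm (h : IsEigenframe A l x y) : IsEigenframe A l⁻¹ y x where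
  eigenvalue_ne_zero := inv_ne_zero h.eigenvalue_ne_zero
  area_ne_zero := by rw [area_swap]; exact neg_ne_zero.2 h.area_ne_zero
  mulVec_left := h.mulVec_right
  mulVec_right := by rw [inv_inv, h.mulVec_left]

lemma left_ne_zero (h : IsEigenframe A l x y) : x ≠ 0 := by
  rintro rfl
  exact h.area_ne_zero (area_zero_left y)

lemma pow (h : IsEigenframe A l x y) (n : ℕ) : IsEigenframe (A ^ n) (l ^ n) x y := by
  induction n with
  | zero => exact ⟨by simp, h.area_ne_zero, by simp, by simp⟩
  | succ n ih =>
    refine ⟨pow_ne_zero _ h.eigenvalue_ne_zero, h.area_ne_zero, ?_, ?_⟩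
    · rw [pow_succ', Matrix.SpecialLinearGroup.coe_mul, ← Matrix.mulVec_mulVec, ih.mulVec_left,
        Matrix.mulVec_smul, h.mulVec_left, smul_smul, pow_succ]
    · rw [pow_succ', Matrix.SpecialLinearGroup.coe_mul, ← Matrix.mulVec_mulVec, ih.mulVec_right,
        Matrix.mulVec_smul, h.mulVec_right, smul_smul, pow_succ, mul_inv]

lemma mk_eq_one (h : IsEigenframe A l x y) (hl : l ^ 2 = 1) : (QuotientGroup.mk A : PSL2) = 1 := by
  have hinv : l⁻¹ = l := inv_eq_of_mul_eq_one_left (by rw [← hl, sq])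
  have hy : area x ((area x y)⁻¹ • y) = 1 := by
    rw [area_smul_right, inv_mul_cancel₀ h.area_ne_zero]
  refine mk_eq_one_of_mulVec_eq_smul (r := l) fun z => ?_
  rw [eq_area_smul_add hy z]
  simp only [Matrix.mulVec_add, Matrix.mulVec_smul, h.mulVec_left, h.mulVec_right, hinv, smul_add,
    smul_comm l]

lemma mk_pow_eq_one (h : IsEigenframe A l x y) {n : ℕ} (hn : (l ^ 2) ^ n = 1) :
    (QuotientGroup.mk A : PSL2) ^ n = 1 := by
  rw [← QuotientGroup.mk_pow]
  exact (h.pow n).mk_eq_one (by rw [← hn, pow_right_comm])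

end IsEigenframe

end Eigenframe

section Axis

variable {x : Fin 2 → ℂ}

/-- The antipodal map in homogeneous coordinates. -/
def conjPerp (x : Fin 2 → ℂ) : Fin 2 → ℂ := ![-star (x 1), star (x 0)]

lemma conjPerp_smul (a : ℂ) (x : Fin 2 → ℂ) : conjPerp (a • x) = star a • conjPerp x := by
  ext i
  fin_cases i <;> simp [conjPerp]

lemma area_conjPerp_ne_zero (hx : x ≠ 0) : area x (conjPerp x) ≠ 0 := by
  have harea : area x (conjPerp x) = ((Complex.normSq (x 0) + Complex.normSq (x 1) : ℝ) : ℂ) := by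
    simp [area, conjPerp, Complex.mul_conj]
  rw [harea, Complex.ofReal_ne_zero]
  intro h
  obtain ⟨h₀, h₁⟩ := (add_eq_zero_iff_of_nonneg (Complex.normSq_nonneg _)
    (Complex.normSq_nonneg _)).1 h
  refine hx (funext fun i => ?_)
  fin_cases i
  · exact Complex.normSq_eq_zero.1 h₀
  · exact Complex.normSq_eq_zero.1 h₁

lemma conjPerp_ne_zero (hx : x ≠ 0) : conjPerp x ≠ 0 := by
  intro h
  refine area_conjPerp_ne_zero hx ?_
  rw [h, area_swap, area_zero_left, neg_zero]

lemma antipode_mk (hx : x ≠ 0) : antipode (Projectivization.mk ℂ x hx) =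
    Projectivization.mk ℂ (conjPerp x) (conjPerp_ne_zero hx) := by
  obtain ⟨a, ha⟩ := Projectivization.exists_smul_eq_mk_rep ℂ x hx
  refine (Projectivization.mk_eq_mk_iff' ℂ _ _ _ _).2 ⟨star (a : ℂ), ?_⟩
  rw [← conjPerp_smul]
  exact congrArg conjPerp ha

lemma mulVec_conjPerp {A : Matrix.SpecialLinearGroup (Fin 2) ℂ}
    (hA : A.1 ∈ Matrix.unitaryGroup (Fin 2) ℂ) (x : Fin 2 → ℂ) :
    A.1 *ᵥ conjPerp x = conjPerp (A.1 *ᵥ x) := by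
  have hstar : star A.1 = A.1.adjugate := by
    rw [← Matrix.SpecialLinearGroup.coe_inv]
    refine left_inv_eq_right_inv (Matrix.mem_unitaryGroup_iff'.1 hA) ?_
    rw [← Matrix.SpecialLinearGroup.coe_mul, mul_inv_cancel, Matrix.SpecialLinearGroup.coe_one]
  have hentry (i j : Fin 2) : starRingEnd ℂ (A.1 j i) = A.1.adjugate i j := congrFun₂ hstar i j
  ext i
  fin_cases i <;> simp [conjPerp, Matrix.mulVec, dotProduct, hentry, Matrix.adjugate_fin_two,
    mul_comm, add_comm]

lemma exists_eigenvector (A : Matrix (Fin 2) (Fin 2) ℂ) :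
    ∃ (l : ℂ) (x : Fin 2 → ℂ), x ≠ 0 ∧ A *ᵥ x = l • x := by
  obtain ⟨l, hl⟩ := Module.End.exists_eigenvalue (Matrix.toLin' A)
  obtain ⟨x, hx⟩ := hl.exists_hasEigenvector
  exact ⟨l, x, hx.2, by simpa only [Matrix.toLin'_apply] using hx.apply_eq_smul⟩

lemma IsRotation.exists_axis {g : PSL2} (hg : IsRotation g) :
    ∃ (A : Matrix.SpecialLinearGroup (Fin 2) ℂ) (l : ℂ) (x : Fin 2 → ℂ),
      (QuotientGroup.mk A : PSL2) = g ∧ IsEigenframe A l x (conjPerp x) := by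
  obtain ⟨A, hA, rfl⟩ := hg
  obtain ⟨l, x, hx, hl⟩ := exists_eigenvector A.1
  have hl' : A.1 *ᵥ conjPerp x = star l • conjPerp x := by
    rw [mulVec_conjPerp hA, hl, conjPerp_smul]
  have har := area_conjPerp_ne_zero hx
  have hunit : l * star l = 1 := by
    have hdet := area_mulVec A x (conjPerp x)
    rw [hl, hl', area_smul_left, area_smul_right, ← mul_assoc] at hdet
    exact mul_right_cancel₀ har (hdet.trans (one_mul _).symm)
  refine ⟨A, l, x, rfl, left_ne_zero_of_mul_eq_one hunit, har, hl, ?_⟩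
  rw [hl', eq_inv_of_mul_eq_one_right hunit]

end Axis

section FixedPoint

variable {f : Coord → ℂ} {k : ℕ} {A : Matrix.SpecialLinearGroup (Fin 2) ℂ} {c α β : ℂ}

lemma IsEntireForm.character_eq_of_fderiv_ne_zero (hf : IsEntireForm f k)
    (hA : ∀ v, f (diagL A.1 v) = c * f v) {v w : Coord} {μ : ℂ} (hv : diagL A.1 v = scaleL α β v)
    (hw : diagL A.1 w = μ • scaleL α β w) (hne : fderiv ℂ f v w ≠ 0) : c = μ * (α ^ k * β ^ k) := by
  have hd := fderiv_apply_of_semiinvariant hf.differentiable (diagL A.1) c hA v w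
  rw [hv, hw, map_smul, hf.fderiv_scaleL, smul_eq_mul, ← mul_assoc] at hd
  exact (mul_right_cancel₀ hne hd).symm

-- The value of the form at the fixed point gives the first alternative; when it vanishes, the
-- eigenvalues of `A` on the tangent space, which are `α⁻²` and `β⁻²`, give the other two.
lemma SmoothEquation.character_at_fixedPoint (hf : SmoothEquation f k)
    (hA : ∀ v, f (diagL A.1 v) = c * f v) {x x' y y' : Fin 2 → ℂ} (hx : IsEigenframe A α x x')
    (hy : IsEigenframe A β y y') :
    c = α ^ k * β ^ k ∨
      f (x, y) = 0 ∧ (c * α ^ 2 = α ^ k * β ^ k ∨ c * β ^ 2 = α ^ k * β ^ k) := by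
  have hv : diagL A.1 (x, y) = scaleL α β (x, y) := by
    rw [diagL_apply, hx.mulVec_left, hy.mulVec_left, scaleL_apply]
  have hα := hx.eigenvalue_ne_zero
  have hβ := hy.eigenvalue_ne_zero
  by_cases hxy : f (x, y) = 0
  · refine Or.inr ⟨hxy, ?_⟩
    rcases hf.fderiv_ne_zero_or ⟨hx.left_ne_zero, hy.left_ne_zero, hxy⟩ hx.area_ne_zero
      hy.area_ne_zero with h | h
    · have hw : diagL A.1 (x', 0) = (α ^ 2)⁻¹ • scaleL α β (x', 0) := by
        have hsq : (α ^ 2)⁻¹ * α = α⁻¹ := by field_simp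
        simp only [diagL_apply, scaleL_apply, Prod.smul_mk, smul_smul, hsq, hx.mulVec_right,
          Matrix.mulVec_zero, smul_zero]
      left
      rw [hf.character_eq_of_fderiv_ne_zero hA hv hw h]
      field_simp
    · have hw : diagL A.1 (0, y') = (β ^ 2)⁻¹ • scaleL α β (0, y') := by
        have hsq : (β ^ 2)⁻¹ * β = β⁻¹ := by field_simp
        simp only [diagL_apply, scaleL_apply, Prod.smul_mk, smul_smul, hsq, hy.mulVec_right,
          Matrix.mulVec_zero, smul_zero]
      right
      rw [hf.character_eq_of_fderiv_ne_zero hA hv hw h]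
      field_simp
  · left
    have hval := hA (x, y)
    rw [hv, hf.map_scaleL] at hval
    exact (mul_right_cancel₀ hxy hval).symm

end FixedPoint

section ProjectiveAction

variable {f : BiPoly} {m : ℕ}

lemma IsBihomogeneous.act_eq_of_mk_eq (hf : IsBihomogeneous f m m)
    {A B : Matrix.SpecialLinearGroup (Fin 2) ℂ}
    (h : (QuotientGroup.mk A : PSL2) = QuotientGroup.mk B) :
    PlatonicCurves.act A.1 f = PlatonicCurves.act B.1 f := by
  obtain ⟨r, hr, hAB⟩ := exists_smul_of_mk_eq h
  refine evalC_injective fun v => ?_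
  have hdiag : diagL B.1 v = scaleL r r (diagL A.1 v) := by
    simp only [diagL_apply, scaleL_apply, hAB]
  rw [evalC_act, evalC_act, hdiag, hf.evalC_scaleL, ← pow_add, ← two_mul, pow_mul, hr, one_pow,
    one_mul]

/-- The substitution of an element of `PSL(2, ℂ)`, through an arbitrary representative: it is
meaningful on forms of bidegree `(m, m)`. -/
def pact (g : PSL2) : BiPoly →ₐ[ℂ] BiPoly := act (Quotient.out g).1

namespace IsBihomogeneous

lemma pact_mk (hf : IsBihomogeneous f m m) (A : Matrix.SpecialLinearGroup (Fin 2) ℂ) :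
    pact (QuotientGroup.mk A) f = PlatonicCurves.act A.1 f :=
  hf.act_eq_of_mk_eq (Quotient.out_eq _)

lemma pact_mul (hf : IsBihomogeneous f m m) (g h : PSL2) :
    pact (g * h) f = pact h (pact g f) := by
  induction g using QuotientGroup.induction_on with | _ A =>
  induction h using QuotientGroup.induction_on with | _ B =>
  rw [← QuotientGroup.mk_mul, hf.pact_mk, hf.pact_mk, (hf.act _).pact_mk,
    Matrix.SpecialLinearGroup.coe_mul, act_mul]

lemma pact_one (hf : IsBihomogeneous f m m) : pact 1 f = f := by
  rw [← QuotientGroup.mk_one, hf.pact_mk, Matrix.SpecialLinearGroup.coe_one, act_one]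

lemma exists_character (hf : IsBihomogeneous f m m) (hf₀ : f ≠ 0) {G : Subgroup PSL2}
    (h : ∀ g ∈ G, ∃ c, pact g f = C c * f) : ∃ χ : G →* ℂ, ∀ g : G, pact g.1 f = C (χ g) * f := by
  choose c hc using fun g : G => h g.1 g.2
  have huniq : ∀ a b : ℂ, C a * f = C b * f → a = b := fun a b hab =>
    C_injective _ _ (mul_right_cancel₀ hf₀ hab)
  have hone : c 1 = 1 := huniq _ _ (by rw [← hc, map_one, one_mul]; exact hf.pact_one)
  have hmul : ∀ g g', c (g * g') = c g * c g' := fun g g' => huniq _ _ (by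
    have hC : pact g'.1 (C (c g)) = C (c g) := (pact g'.1).commutes (c g)
    rw [← hc, Subgroup.coe_mul, hf.pact_mul, hc g, map_mul, hC, hc g', map_mul, mul_assoc])
  exact ⟨⟨⟨c, hone⟩, hmul⟩, hc⟩

lemma exists_pact_eq_C_mul (hf : IsBihomogeneous f m m) (hs : SmoothEquation (evalC f) m)
    (hm : m ≠ 0) {g : PSL2}
    (hinv : ∀ p ∈ PlatonicCurves.zeroLocus f, g • p ∈ PlatonicCurves.zeroLocus f) :
    ∃ c, pact g f = C c * f := by
  induction g using QuotientGroup.induction_on with | _ A =>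
  rw [hf.pact_mk]
  refine hf.exists_eq_C_mul_of_vanishing hs (hf.act A.1) hm fun v hv => ?_
  have hmem := hinv _ ((hf.mem_zeroLocus_mk_iff hv.1 hv.2.1).2 hv.2.2)
  rw [evalC_act]
  exact (hf.mem_zeroLocus_mk_iff (mulVec_ne_zero A hv.1) (mulVec_ne_zero A hv.2.1)).1 hmem

end IsBihomogeneous

namespace SmoothEquation

variable {k : ℕ} {g : PSL2} {c : ℂ}

lemma dvd_or_dvd (hs : SmoothEquation (evalC f) k) (hf : IsBihomogeneous f k k) (hk : k ≠ 0)
    (hg : IsRotation g) (hinv : pact g f = f) : orderOf g ∣ k ∨ orderOf g ∣ k - 1 := by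
  obtain ⟨A, l, x, rfl, hx⟩ := hg.exists_axis
  rw [hf.pact_mk] at hinv
  have hA (v : Coord) : evalC f (diagL A.1 v) = 1 * evalC f v := by
    rw [← evalC_act, hinv, one_mul]
  rcases hs.character_at_fixedPoint hA hx hx with h | ⟨-, h⟩
  · refine Or.inl (orderOf_dvd_of_pow_eq_one (hx.mk_pow_eq_one ?_))
    rw [← pow_mul, two_mul, pow_add, h]
  · refine Or.inr (orderOf_dvd_of_pow_eq_one (hx.mk_pow_eq_one ?_))
    obtain ⟨j, rfl⟩ := Nat.exists_eq_succ_of_ne_zero hk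
    rw [or_self] at h
    refine mul_right_cancel₀ (pow_ne_zero 2 hx.eigenvalue_ne_zero) ?_
    rw [h, Nat.succ_sub_one, Nat.succ_eq_add_one]
    ring

-- The fixed point `(x, conjPerp x)` lies on the antidiagonal, and the two factors of
-- `α ^ k * β ^ k` cancel there because `β = α⁻¹`.
lemma character_at_antidiagonal (hs : SmoothEquation (evalC f) k) (hf : IsBihomogeneous f k k)
    {A : Matrix.SpecialLinearGroup (Fin 2) ℂ} {l : ℂ} {x : Fin 2 → ℂ}
    (hx : IsEigenframe A l x (conjPerp x)) (hc : pact (QuotientGroup.mk A) f = C c * f) :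
    c = 1 ∨ evalC f (x, conjPerp x) = 0 ∧ (c * l ^ 2 = 1 ∨ c = l ^ 2) := by
  rw [hf.pact_mk] at hc
  have hA (v : Coord) : evalC f (diagL A.1 v) = c * evalC f v := by
    rw [← evalC_act, hc, evalC_mul, evalC_C]
  have hone : l ^ k * l⁻¹ ^ k = 1 := by
    rw [← mul_pow, mul_inv_cancel₀ hx.eigenvalue_ne_zero, one_pow]
  have h := hs.character_at_fixedPoint hA hx hx.symm
  rwa [hone, inv_pow, mul_inv_eq_one₀ (pow_ne_zero 2 hx.eigenvalue_ne_zero)] at h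

lemma character_eq_one_of_sq_ne_one (hs : SmoothEquation (evalC f) k)
    (hf : IsBihomogeneous f k k) (hg : IsRotation g) (hc : pact g f = C c * f) (hc₂ : c ^ 2 = 1)
    (hg₂ : g ^ 2 ≠ 1) : c = 1 := by
  obtain ⟨A, l, x, rfl, hx⟩ := hg.exists_axis
  by_contra hc₁
  refine hg₂ (hx.mk_pow_eq_one ?_)
  rcases ((hs.character_at_antidiagonal hf hx hc).resolve_left hc₁).2 with h | h
  · linear_combination (c * l ^ 2 + 1) * h - l ^ 4 * hc₂
  · rw [← h, hc₂]

lemma character_eq_one_of_subset_twistorSpace (hs : SmoothEquation (evalC f) k)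
    (hf : IsBihomogeneous f k k) (hZ : PlatonicCurves.zeroLocus f ⊆ twistorSpace)
    (hg : IsRotation g) (hc : pact g f = C c * f) : c = 1 := by
  obtain ⟨A, l, x, rfl, hx⟩ := hg.exists_axis
  refine (hs.character_at_antidiagonal hf hx hc).resolve_right fun ⟨h, _⟩ => ?_
  have hx₀ := hx.left_ne_zero
  exact hZ ((hf.mem_zeroLocus_mk_iff hx₀ (conjPerp_ne_zero hx₀)).2 h) (antipode_mk hx₀).symm

end SmoothEquation

end ProjectiveAction

end RotationCharacters

section AxisForms

namespace IsBihomogeneous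

lemma C_mul {f : BiPoly} {a b : ℕ} (hf : IsBihomogeneous f a b) (c : ℂ) :
    IsBihomogeneous (C c * f) a b := by
  rw [← smul_eq_C_mul]
  exact (weightedHomogeneousSubmodule ℂ _ _).smul_mem c hf

lemma area {p q : Fin 2 → BiPoly} {a b c d : ℕ} (hp : ∀ i, IsBihomogeneous (p i) a b)
    (hq : ∀ i, IsBihomogeneous (q i) c d) :
    IsBihomogeneous (PlatonicCurves.area p q) (a + c) (b + d) :=
  ((hp 0).mul (hq 1)).sub ((hp 1).mul (hq 0))

lemma map_C_mulVec {p : Fin 2 → BiPoly} {a b : ℕ} (hp : ∀ i, IsBihomogeneous (p i) a b)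
    (A : Matrix (Fin 2) (Fin 2) ℂ) (i : Fin 2) : IsBihomogeneous ((A.map C *ᵥ p) i) a b :=
  IsWeightedHomogeneous.sum _ _ _ fun j _ => (hp j).C_mul (A i j)

end IsBihomogeneous

lemma isBihomogeneous_X_inl (i : Fin 2) : IsBihomogeneous (X (Sum.inl i)) 1 0 :=
  isWeightedHomogeneous_X _ _ _

lemma isBihomogeneous_X_inr (i : Fin 2) : IsBihomogeneous (X (Sum.inr i)) 0 1 :=
  isWeightedHomogeneous_X _ _ _

/-- The equation of the diagonal. -/
def diagForm : BiPoly := area (X ∘ Sum.inl) (X ∘ Sum.inr)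

lemma isBihomogeneous_diagForm : IsBihomogeneous diagForm 1 1 :=
  .area isBihomogeneous_X_inl isBihomogeneous_X_inr

lemma evalC_area (p q : Fin 2 → BiPoly) (v : Coord) :
    evalC (area p q) v = area (fun i => evalC (p i) v) fun i => evalC (q i) v :=
  map_area (eval (Sum.elim v.1 v.2)) p q

lemma evalC_map_C_mulVec (A : Matrix (Fin 2) (Fin 2) ℂ) (p : Fin 2 → BiPoly) (v : Coord) :
    (fun i => evalC ((A.map C *ᵥ p) i) v) = A *ᵥ fun i => evalC (p i) v := by
  ext i
  simp [Matrix.mulVec, dotProduct]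

lemma evalC_diagForm (v : Coord) : evalC diagForm v = area v.1 v.2 := by
  simp only [diagForm, evalC_area, Function.comp_apply, evalC_X, Sum.elim_inl, Sum.elim_inr]

lemma diagForm_ne_zero : diagForm ≠ 0 := by
  intro h
  have heval := evalC_diagForm (![1, 0], ![0, 1])
  rw [h] at heval
  simp [evalC, area] at heval

lemma pact_diagForm (g : PSL2) : pact g diagForm = diagForm := by
  refine evalC_injective fun v => ?_
  rw [pact, evalC_act, evalC_diagForm, evalC_diagForm, diagL_apply, area_mulVec]

/-- The polarization of the quadratic form `x ∧ A x`, whose zeros are the fixed points of `A` on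
the projective line. -/
def axisForm (A : Matrix (Fin 2) (Fin 2) ℂ) : BiPoly :=
  area (X ∘ Sum.inl) (A.map C *ᵥ X ∘ Sum.inr) + area (X ∘ Sum.inr) (A.map C *ᵥ X ∘ Sum.inl)

section

variable (A B : Matrix.SpecialLinearGroup (Fin 2) ℂ)

lemma isBihomogeneous_axisForm (A : Matrix (Fin 2) (Fin 2) ℂ) : IsBihomogeneous (axisForm A) 1 1 :=
  IsWeightedHomogeneous.add
    (IsBihomogeneous.area isBihomogeneous_X_inl
      (IsBihomogeneous.map_C_mulVec isBihomogeneous_X_inr A))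
    (IsBihomogeneous.area isBihomogeneous_X_inr
      (IsBihomogeneous.map_C_mulVec isBihomogeneous_X_inl A))

lemma evalC_axisForm (A : Matrix (Fin 2) (Fin 2) ℂ) (v : Coord) :
    evalC (axisForm A) v = area v.1 (A *ᵥ v.2) + area v.2 (A *ᵥ v.1) := by
  simp only [axisForm, evalC_add, evalC_area, evalC_map_C_mulVec, Function.comp_apply, evalC_X,
    Sum.elim_inl, Sum.elim_inr]

lemma act_axisForm : act B.1 (axisForm A.1) = axisForm (B⁻¹ * A * B).1 := by
  have hconj (x : Fin 2 → ℂ) : A.1 *ᵥ (B.1 *ᵥ x) = B.1 *ᵥ ((B⁻¹ * A * B).1 *ᵥ x) := by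
    rw [Matrix.mulVec_mulVec, Matrix.mulVec_mulVec, ← Matrix.SpecialLinearGroup.coe_mul,
      ← Matrix.SpecialLinearGroup.coe_mul, ← mul_assoc, mul_inv_cancel_left]
  refine evalC_injective fun v => ?_
  simp only [evalC_act, evalC_axisForm, diagL_apply, hconj, area_mulVec]

lemma axisForm_inv : axisForm (A⁻¹).1 = -axisForm A.1 := by
  have hcancel (x : Fin 2 → ℂ) : A.1 *ᵥ ((A⁻¹).1 *ᵥ x) = x := by
    rw [Matrix.mulVec_mulVec, ← Matrix.SpecialLinearGroup.coe_mul, mul_inv_cancel,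
      Matrix.SpecialLinearGroup.coe_one, Matrix.one_mulVec]
  refine eq_neg_of_add_eq_zero_left (evalC_injective fun v => ?_)
  rw [evalC_add, evalC_axisForm, evalC_axisForm, ← area_mulVec A v.1, ← area_mulVec A v.2, hcancel,
    hcancel, area_swap v.2, area_swap v.1, evalC, map_zero]
  ring

variable {A B} in
lemma axisForm_sq_eq_of_mk_eq (h : (QuotientGroup.mk A : PSL2) = QuotientGroup.mk B) :
    axisForm A.1 ^ 2 = axisForm B.1 ^ 2 := by
  obtain ⟨r, hr, hAB⟩ := exists_smul_of_mk_eq h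
  refine evalC_injective fun v => ?_
  simp only [evalC_pow, evalC_axisForm, hAB, area_smul_right, ← mul_add, mul_pow, hr, one_mul]

end

/-- The square of the form of an axis, which depends only on the rotation. -/
def axisSq (g : PSL2) : BiPoly := axisForm (Quotient.out g).1 ^ 2

lemma axisSq_mk (A : Matrix.SpecialLinearGroup (Fin 2) ℂ) :
    axisSq (QuotientGroup.mk A) = axisForm A.1 ^ 2 :=
  axisForm_sq_eq_of_mk_eq (Quotient.out_eq _)

lemma isBihomogeneous_axisSq (g : PSL2) : IsBihomogeneous (axisSq g) 2 2 :=
  (isBihomogeneous_axisForm _).pow 2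

lemma pact_axisSq (g h : PSL2) : pact h (axisSq g) = axisSq (h⁻¹ * g * h) := by
  induction g using QuotientGroup.induction_on with | _ A =>
  induction h using QuotientGroup.induction_on with | _ B =>
  rw [(isBihomogeneous_axisSq _).pact_mk, axisSq_mk, map_pow, act_axisForm,
    ← QuotientGroup.mk_inv, ← QuotientGroup.mk_mul, ← QuotientGroup.mk_mul, axisSq_mk]

lemma axisSq_inv (g : PSL2) : axisSq g⁻¹ = axisSq g := by
  induction g using QuotientGroup.induction_on with | _ A =>
  rw [← QuotientGroup.mk_inv, axisSq_mk, axisSq_mk, axisForm_inv, neg_sq]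

/-- The restriction of a form to the diagonal. -/
def toDiag : BiPoly →ₐ[ℂ] MvPolynomial (Fin 2) ℂ := aeval (Sum.elim X X)

lemma eval_toDiag (f : BiPoly) (x : Fin 2 → ℂ) : eval x (toDiag f) = evalC f (x, x) := by
  rw [toDiag, ← coe_aeval_eq_eval, RingHom.coe_coe, ← AlgHom.comp_apply, comp_aeval, evalC,
    ← coe_aeval_eq_eval, RingHom.coe_coe]
  congr 2
  ext i
  cases i <;> simp

lemma toDiag_diagForm : toDiag diagForm = 0 := by
  refine MvPolynomial.funext fun x => ?_
  rw [eval_toDiag, evalC_diagForm, area_self, map_zero]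

lemma exists_mulVec_eq_smul_of_area_mulVec_eq_zero {A : Matrix (Fin 2) (Fin 2) ℂ}
    (h : ∀ x, area x (A *ᵥ x) = 0) : ∃ r : ℂ, ∀ x, A *ᵥ x = r • x := by
  have h₀ : A 1 0 = 0 := by simpa [area] using h ![1, 0]
  have h₁ : A 0 1 = 0 := by simpa [area] using h ![0, 1]
  have h₂ : A 1 1 = A 0 0 := by
    simpa [area, Matrix.mulVec, dotProduct, h₀, h₁, sub_eq_zero] using h ![1, 1]
  refine ⟨A 0 0, fun x => ?_⟩
  ext i
  fin_cases i <;> simp [Matrix.mulVec, dotProduct, h₀, h₁, h₂]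

lemma toDiag_axisForm_ne_zero {A : Matrix.SpecialLinearGroup (Fin 2) ℂ}
    (hA : (QuotientGroup.mk A : PSL2) ≠ 1) : toDiag (axisForm A.1) ≠ 0 := by
  intro h
  obtain ⟨r, hr⟩ := exists_mulVec_eq_smul_of_area_mulVec_eq_zero fun x => by
    have heval := eval_toDiag (axisForm A.1) x
    rw [h, map_zero, evalC_axisForm] at heval
    exact self_eq_neg.1 (eq_neg_of_add_eq_zero_left heval.symm)
  exact hA (mk_eq_one_of_mulVec_eq_smul hr)

end AxisForms

section PreservesAxis

variable {H H' : Type*} [Group H] [Group H'] {K : Finset H} {σ : H}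

/-- Conjugation by the elements of `K` maps `σ` to `σ` or `σ⁻¹`: when `σ` is a rotation, the
elements of `K` map its axis to itself. -/
abbrev PreservesAxis (K : Finset H) (σ : H) : Prop :=
  ∀ τ ∈ K, τ⁻¹ * σ * τ = σ ∨ τ⁻¹ * σ * τ = σ⁻¹

lemma PreservesAxis.map (h : PreservesAxis K σ) (φ : H ≃* H') :
    PreservesAxis (K.map φ.toEquiv.toEmbedding) (φ σ) := by
  intro τ hτ
  obtain ⟨ρ, hρ, rfl⟩ := Finset.mem_map.1 hτ
  refine (h ρ hρ).imp (fun hρ => ?_) fun hρ => ?_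
  · simpa using congrArg φ hρ
  · simpa using congrArg φ hρ

end PreservesAxis

section FormOrbits

variable {G : Subgroup PSL2} [Fintype G] {f : BiPoly} {m : ℕ}

lemma pact_injective (g : PSL2) : Function.Injective (pact g) :=
  Function.LeftInverse.injective (act_inv_act (Quotient.out g))

open Classical in
/-- The orbit of a form under the substitutions by the elements of `G`. -/
def formOrbit (G : Subgroup PSL2) [Fintype G] (f : BiPoly) : Finset BiPoly :=
  Finset.univ.image fun g : G => pact g.1 f

lemma mem_formOrbit {p : BiPoly} : p ∈ formOrbit G f ↔ ∃ g : G, pact g.1 f = p := by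
  simp [formOrbit]

lemma IsBihomogeneous.pact_mem_formOrbit (hf : IsBihomogeneous f m m) (g : G) {p : BiPoly}
    (hp : p ∈ formOrbit G f) : pact g.1 p ∈ formOrbit G f := by
  obtain ⟨h, rfl⟩ := mem_formOrbit.1 hp
  exact mem_formOrbit.2 ⟨h * g, hf.pact_mul _ _⟩

lemma IsBihomogeneous.pact_prod_formOrbit (hf : IsBihomogeneous f m m) (g : G) :
    pact g.1 (∏ p ∈ formOrbit G f, p) = ∏ p ∈ formOrbit G f, p := by
  rw [map_prod]
  have hmaps : Set.MapsTo (pact g.1) (formOrbit G f) (formOrbit G f) := fun p =>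
    hf.pact_mem_formOrbit g
  exact Finset.prod_nbij (pact g.1) hmaps (pact_injective _).injOn
    (Finset.surjOn_of_injOn_of_card_le _ hmaps (pact_injective _).injOn le_rfl) fun _ _ => rfl

open Classical in
lemma IsBihomogeneous.card_mul_card_formOrbit_le (hf : IsBihomogeneous f m m) (K : Finset G)
    (hK : ∀ k ∈ K, pact k.1 f = f) : K.card * (formOrbit G f).card ≤ Fintype.card G := by
  refine Finset.mul_card_image_le_card Finset.univ K.card fun p hp => ?_
  obtain ⟨g, -, rfl⟩ := Finset.mem_image.1 hp
  refine Finset.card_le_card_of_injOn (· * g) (fun k hk => ?_) (mul_left_injective g).injOn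
  refine Finset.mem_coe.2 (Finset.mem_filter.2 ⟨Finset.mem_univ _, ?_⟩)
  rw [Subgroup.coe_mul, hf.pact_mul, hK k hk]

theorem exists_form_of_axes {g : G} (hg : g ≠ 1) {K : Finset G} (hK : PreservesAxis K g) :
    ∃ (j : ℕ) (P : BiPoly), IsBihomogeneous P j j ∧ j ≠ 0 ∧ K.card * j ≤ Fintype.card G ∧
      toDiag P ≠ 0 ∧ ∀ h : G, pact h.1 P ^ 2 = P ^ 2 := by
  have hb := isBihomogeneous_axisSq g.1
  have hroot : ∀ p ∈ formOrbit G (axisSq g.1),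
      ∃ r, IsBihomogeneous r 1 1 ∧ r ^ 2 = p ∧ toDiag r ≠ 0 := fun p hp => by
    obtain ⟨h, rfl⟩ := mem_formOrbit.1 hp
    rw [pact_axisSq]
    refine ⟨_, isBihomogeneous_axisForm _, rfl, toDiag_axisForm_ne_zero ?_⟩
    rw [QuotientGroup.out_eq']
    simpa [mul_assoc, mul_eq_one_iff_eq_inv] using hg
  choose! r hr₁ hr₂ hr₃ using hroot
  refine ⟨(formOrbit G (axisSq g.1)).card, ∏ p ∈ formOrbit G (axisSq g.1), r p, ?_, ?_, ?_, ?_,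
    fun h => ?_⟩
  · have hprod := IsWeightedHomogeneous.prod _ r (fun _ => ((1, 1) : ℕ × ℕ)) hr₁
    simpa [IsBihomogeneous] using hprod
  · exact Finset.card_ne_zero.2 ⟨_, mem_formOrbit.2 ⟨1, rfl⟩⟩
  · refine hb.card_mul_card_formOrbit_le K fun k hk => ?_
    rw [pact_axisSq, ← Subgroup.coe_inv, ← Subgroup.coe_mul, ← Subgroup.coe_mul]
    rcases hK k hk with h | h
    · rw [h]
    · rw [h, Subgroup.coe_inv, axisSq_inv]
  · rw [map_prod, Finset.prod_ne_zero_iff]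
    exact hr₃
  · rw [← map_pow, ← Finset.prod_pow, Finset.prod_congr rfl hr₂, hb.pact_prod_formOrbit]

end FormOrbits

section InvariantForms

variable {G : Subgroup PSL2} {f : BiPoly} {m : ℕ}

lemma linearIndependent_mul_diagForm_pow {P : BiPoly} {j m : ℕ} (hj : j ≠ 0) (hjm : j ≤ m)
    (hP : toDiag P ≠ 0) :
    LinearIndependent ℂ ![P * diagForm ^ (m - j), diagForm ^ m] := by
  refine LinearIndependent.pair_iff.2 fun a b h => ?_
  rw [smul_eq_C_mul, smul_eq_C_mul] at h
  have hfac : (C a * P + C b * diagForm ^ j) * diagForm ^ (m - j) = 0 := by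
    rw [add_mul, mul_assoc, mul_assoc, ← pow_add, Nat.add_sub_cancel' hjm, h]
  have hsum := (mul_eq_zero.1 hfac).resolve_right (pow_ne_zero _ diagForm_ne_zero)
  have ha : a = 0 := by
    have hd := congrArg toDiag hsum
    rw [map_add, map_mul, map_mul, map_pow, toDiag_diagForm, zero_pow hj, mul_zero, add_zero,
      map_zero] at hd
    exact C_eq_zero.1 ((toDiag.commutes a).symm.trans ((mul_eq_zero.1 hd).resolve_right hP))
  rw [ha, map_zero, zero_mul, zero_add] at hsum
  exact ⟨ha, C_eq_zero.1 ((mul_eq_zero.1 hsum).resolve_right (pow_ne_zero _ diagForm_ne_zero))⟩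

lemma isInvariant_evalC (h : ∀ g : G, pact g.1 f = f) :
    IsInvariant (fun g : G => Quotient.out g.1) (evalC f) := fun g v => by
  rw [← evalC_act]
  exact congrArg (evalC · v) (h g)

theorem TorusMap.false_of_invariant [Finite G] {P : BiPoly} {j : ℕ}
    {L : PeriodPair} {q : Coord → ℂ ⧸ L.lattice} (hf : IsBihomogeneous f (m + 2) (m + 2))
    (hs : SmoothEquation (evalC f) (m + 2))
    (hq : TorusMap (evalC f) L (fun g : G => Quotient.out g.1) q)
    (hfG : ∀ g : G, pact g.1 f = f) (hP : IsBihomogeneous P j j) (hj : j ≠ 0) (hjm : j ≤ m)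
    (hPG : ∀ g : G, pact g.1 P = P) (hPd : toDiag P ≠ 0) : False := by
  have h₁ : IsBihomogeneous (P * diagForm ^ (m - j)) m m := by
    simpa [IsBihomogeneous, hjm] using hP.mul (isBihomogeneous_diagForm.pow (m - j))
  have h₂ : IsBihomogeneous (diagForm ^ m) m m := by
    simpa [IsBihomogeneous] using isBihomogeneous_diagForm.pow m
  have hG₁ (g : G) : pact g.1 (P * diagForm ^ (m - j)) = P * diagForm ^ (m - j) := by
    rw [map_mul, map_pow, hPG, pact_diagForm]
  have hG₂ (g : G) : pact g.1 (diagForm ^ m) = diagForm ^ m := by rw [map_pow, pact_diagForm]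
  obtain ⟨a, b, hab, h⟩ := hq.exists_linear_relation hs (isInvariant_evalC hfG) h₁.isEntireForm
    (isInvariant_evalC hG₁) h₂.isEntireForm (isInvariant_evalC hG₂)
  have hzero := hf.eq_zero_of_vanishing hs ((h₁.C_mul a).add (h₂.C_mul b)) (by lia) (by lia)
    fun v hv => by simpa only [evalC_add, evalC_mul (C _), evalC_C] using h v hv
  rw [← smul_eq_C_mul, ← smul_eq_C_mul] at hzero
  obtain ⟨ha, hb⟩ :=
    LinearIndependent.pair_iff.1 (linearIndependent_mul_diagForm_pow hj hjm hPd) a b hzero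
  exact hab.elim (fun h => h ha) fun h => h hb

end InvariantForms

section Permutations

section Hom

variable {M : Type*} [CommMonoid M]

lemma sq_eq_one_of_isConj_inv {H : Type*} [Group H] (χ : H →* M) {g : H} (h : IsConj g g⁻¹) :
    χ g ^ 2 = 1 := by
  have heq : χ g = χ g⁻¹ := isConj_iff_eq.1 (χ.map_isConj h)
  rw [sq]
  nth_rw 2 [heq]
  rw [← map_mul, mul_inv_cancel, map_one]

variable {α : Type*} [Fintype α] [DecidableEq α]

lemma alternatingGroup_hom_eq_one (χ : alternatingGroup α →* M)
    (h : ∀ g : alternatingGroup α, (g : Perm α).IsThreeCycle → χ g ^ 2 = 1) : χ = 1 := by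
  refine MonoidHom.eq_of_eqOn_dense alternatingGroup.closure_isThreeCycles_eq_top fun g hg => ?_
  have hg₃ : (g : Perm α).IsThreeCycle := hg
  have hcube : χ g ^ 3 = 1 := by
    rw [← map_pow, ← hg₃.orderOf, Subgroup.orderOf_coe, pow_orderOf_eq_one, map_one]
  rwa [pow_succ, h g hg₃, one_mul] at hcube

lemma alternatingGroup_hom_eq_one_of_five_le_card (hα : 5 ≤ Fintype.card α)
    (χ : alternatingGroup α →* M) : χ = 1 :=
  alternatingGroup_hom_eq_one χ fun g hg => sq_eq_one_of_isConj_inv χ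
    (alternatingGroup.isThreeCycle_isConj (by simpa using hα) hg (by simpa using hg))

lemma perm_hom_apply_eq_one (χ : Perm α →* M) {σ : Perm α} (hσ : σ ∈ alternatingGroup α) :
    χ σ = 1 := by
  have h := alternatingGroup_hom_eq_one (χ.comp (alternatingGroup α).subtype) fun g _ =>
    sq_eq_one_of_isConj_inv χ (Perm.isConj_iff_cycleType_eq.2 (by rw [Perm.cycleType_inv]))
  exact DFunLike.congr_fun h ⟨σ, hσ⟩

lemma perm_hom_eq_one (χ : Perm α →* M) {τ : Perm α} (hτ : Perm.sign τ = -1) (h : χ τ = 1) :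
    χ = 1 := by
  ext σ
  rcases Int.units_eq_one_or (Perm.sign σ) with hσ | hσ
  · exact perm_hom_apply_eq_one χ (Perm.mem_alternatingGroup.2 hσ)
  · rw [← inv_mul_cancel_right σ τ, map_mul, h, mul_one]
    exact perm_hom_apply_eq_one χ (Perm.mem_alternatingGroup.2 (by simp [hσ, hτ]))

end Hom

lemma exists_orderOf_eq_three_alternatingGroup {n : ℕ} (hn : 3 ≤ n) :
    ∃ g : alternatingGroup (Fin n), orderOf g = 3 := by
  have h : Perm.IsThreeCycle (swap (⟨0, by lia⟩ : Fin n) ⟨1, by lia⟩ *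
      swap (⟨0, by lia⟩ : Fin n) ⟨2, by lia⟩) :=
    Perm.isThreeCycle_swap_mul_swap_same (by simp) (by simp) (by simp)
  exact ⟨⟨_, h.mem_alternatingGroup⟩, by rw [← Subgroup.orderOf_coe]; exact h.orderOf⟩

lemma orderOf_finRotate_four : orderOf (finRotate 4) = 4 :=
  orderOf_eq_prime_pow (p := 2) (n := 1) (by decide) (by decide)

/-- A cyclic permutation of five letters, as an element of the alternating group. -/
def fiveCycle : alternatingGroup (Fin 5) := ⟨finRotate 5, Perm.mem_alternatingGroup.2 (by decide)⟩

lemma orderOf_fiveCycle : orderOf fiveCycle = 5 :=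
  have : Fact (Nat.Prime 5) := ⟨by norm_num⟩
  orderOf_eq_prime (by decide) (by decide)

lemma swap_mul_swap_mem_alternatingGroup {n : ℕ} {a b c d : Fin n} (hab : a ≠ b) (hcd : c ≠ d) :
    swap a b * swap c d ∈ alternatingGroup (Fin n) := by
  simp [Perm.mem_alternatingGroup, Perm.sign_swap hab, Perm.sign_swap hcd]

lemma exists_preservesAxis_alternatingGroup_four :
    ∃ (σ : alternatingGroup (Fin 4)) (K : Finset (alternatingGroup (Fin 4))),
      σ ≠ 1 ∧ K.card = 4 ∧ PreservesAxis K σ := by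
  let a : alternatingGroup (Fin 4) :=
    ⟨swap 0 1 * swap 2 3, swap_mul_swap_mem_alternatingGroup (by decide) (by decide)⟩
  let b : alternatingGroup (Fin 4) :=
    ⟨swap 0 2 * swap 1 3, swap_mul_swap_mem_alternatingGroup (by decide) (by decide)⟩
  exact ⟨a, {1, a, b, a * b}, by decide, by decide, by decide⟩

lemma exists_preservesAxis_perm_four :
    ∃ (σ : Perm (Fin 4)) (K : Finset (Perm (Fin 4))), σ ≠ 1 ∧ K.card = 8 ∧ PreservesAxis K σ :=
  ⟨finRotate 4 ^ 2, (Finset.univ : Finset (Fin 4 × Fin 2)).image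
    fun p => finRotate 4 ^ p.1.1 * swap 0 2 ^ p.2.1, by decide, by decide, by decide⟩

set_option maxRecDepth 4000 in
lemma exists_preservesAxis_alternatingGroup_five :
    ∃ (σ : alternatingGroup (Fin 5)) (K : Finset (alternatingGroup (Fin 5))),
      σ ≠ 1 ∧ K.card = 10 ∧ PreservesAxis K σ := by
  let b : alternatingGroup (Fin 5) :=
    ⟨swap 0 4 * swap 1 3, swap_mul_swap_mem_alternatingGroup (by decide) (by decide)⟩
  exact ⟨fiveCycle, (Finset.univ : Finset (Fin 5 × Fin 2)).image
    fun p => fiveCycle ^ p.1.1 * b ^ p.2.1, by decide, by decide, by decide⟩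

end Permutations

section Classification

/-- A bihomogeneous equation of a smooth curve whose quotient by `G` is an elliptic curve. The
quotient map is recorded on the cone over the curve, and `G` acts there through arbitrary
representatives in `SL(2, ℂ)`. -/
structure EllipticModel (G : Subgroup PSL2) (k : ℕ) (f : BiPoly) : Prop where
  bihomogeneous : IsBihomogeneous f k k
  smooth : SmoothEquation (evalC f) k
  exists_torusMap : ∃ (L : PeriodPair) (q : Coord → ℂ ⧸ L.lattice),
    TorusMap (evalC f) L (fun g : G => Quotient.out g.1) q

variable {G : Subgroup PSL2} {k : ℕ} {f : BiPoly}

lemma IsSmoothCurve.exists_ellipticModel {S : Set (P1 × P1)} (hS : IsSmoothCurve k S)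
    (hE : HasEllipticQuotient G S) : ∃ f, EllipticModel G k f ∧ S = zeroLocus f := by
  obtain ⟨f, hf, rfl, hs⟩ := hS
  refine ⟨f, ⟨hf, ⟨hf.isEntireForm, fun v hv => ?_⟩, hf.exists_torusMap hE⟩, rfl⟩
  obtain ⟨i, hi⟩ := hs v.1 v.2 hv.1 hv.2.1 hv.2.2
  intro hd
  rw [← evalC, ← fderiv_evalC_coordSingle f v, hd] at hi
  exact hi rfl

section GroupIso

variable {H : Type*} [Group H]

lemma exists_form_of_mulEquiv [Fintype H] (φ : G ≃* H) {σ : H} (hσ : σ ≠ 1) {K : Finset H}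
    (hK : PreservesAxis K σ) :
    ∃ (j : ℕ) (P : BiPoly), IsBihomogeneous P j j ∧ j ≠ 0 ∧ K.card * j ≤ Fintype.card H ∧
      toDiag P ≠ 0 ∧ ∀ g : G, pact g.1 P ^ 2 = P ^ 2 := by
  let _ : Fintype G := Fintype.ofEquiv H φ.symm.toEquiv
  obtain ⟨j, P, hP, hj, hle, hd, hG⟩ :=
    exists_form_of_axes (g := φ.symm σ) (by simpa using hσ) (hK.map φ.symm)
  rw [Finset.card_map, Fintype.card_congr φ.toEquiv] at hle
  exact ⟨j, P, hP, hj, hle, hd, hG⟩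

lemma IsBihomogeneous.pact_eq_of_forall_hom_eq_one {j : ℕ} (hf : IsBihomogeneous f j j)
    (hf₀ : f ≠ 0) (h : ∀ g ∈ G, ∃ c, pact g f = C c * f) (φ : G ≃* H)
    (hH : ∀ ψ : H →* ℂ, (∀ σ, pact (φ.symm σ).1 f = C (ψ σ) * f) → ψ = 1) (g : G) :
    pact g.1 f = f := by
  obtain ⟨χ, hχ⟩ := hf.exists_character hf₀ h
  have hone := hH (χ.comp φ.symm.toMonoidHom) fun σ => hχ (φ.symm σ)
  have hg : χ g = 1 := by simpa using DFunLike.congr_fun hone (φ g)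
  rw [hχ, hg, C_1, one_mul]

end GroupIso

lemma IsBihomogeneous.pact_eq_of_sq_eq {P : BiPoly} {j n : ℕ} (hP : IsBihomogeneous P j j)
    (hP₀ : P ≠ 0) (hPG : ∀ g : G, pact g.1 P ^ 2 = P ^ 2) (φ : G ≃* alternatingGroup (Fin n))
    (g : G) : pact g.1 P = P := by
  have hsign (g : G) : ∃ c : ℂ, c ^ 2 = 1 ∧ pact g.1 P = C c * P := by
    rcases sq_eq_sq_iff_eq_or_eq_neg.1 (hPG g) with h | h
    · exact ⟨1, one_pow 2, by rw [h, C_1, one_mul]⟩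
    · exact ⟨-1, neg_one_sq, by rw [h, C_neg, C_1, neg_one_mul]⟩
  refine hP.pact_eq_of_forall_hom_eq_one hP₀
    (fun g hg => (hsign ⟨g, hg⟩).imp fun _ hc => hc.2) φ (fun ψ hψ => ?_) g
  refine alternatingGroup_hom_eq_one ψ fun σ _ => ?_
  obtain ⟨c, hc, h⟩ := hsign (φ.symm σ)
  rw [hψ] at h
  rwa [C_injective _ _ (mul_right_cancel₀ hP₀ h)]

namespace EllipticModel

variable [Finite G]

lemma two_le (h : EllipticModel G k f) : 2 ≤ k := by
  obtain ⟨L, q, hq⟩ := h.exists_torusMap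
  by_contra! hk
  interval_cases k
  · obtain ⟨v, hv, -⟩ := hq.exists_eq 0
    refine h.smooth.fderiv_ne_zero v hv ?_
    have hconst : evalC f = fun _ => evalC f 0 := by
      ext w
      simpa [← Prod.zero_eq_mk] using (h.smooth.map_scaleL 0 0 w).symm
    rw [hconst, fderiv_fun_const]
    rfl
  · exact hq.false_of_degree_one h.smooth

section Invariance

variable (h : EllipticModel G k f) (hinv : ∀ g ∈ G, ∀ p ∈ zeroLocus f, g • p ∈ zeroLocus f)

include h hinv

lemma pact_eq_of_forall_hom_eq_one {H : Type*} [Group H] (φ : G ≃* H)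
    (hH : ∀ ψ : H →* ℂ, (∀ σ, pact (φ.symm σ).1 f = C (ψ σ) * f) → ψ = 1) (g : G) :
    pact g.1 f = f :=
  h.bihomogeneous.pact_eq_of_forall_hom_eq_one h.smooth.poly_ne_zero (fun g hg =>
    h.bihomogeneous.exists_pact_eq_C_mul h.smooth (by have := h.two_le; lia) (hinv g hg)) φ hH g

lemma pact_eq_of_subset_twistorSpace (hG : ∀ g ∈ G, IsRotation g)
    (hZ : zeroLocus f ⊆ twistorSpace) (g : G) : pact g.1 f = f := by
  refine h.pact_eq_of_forall_hom_eq_one hinv (.refl G) (fun ψ hψ => ?_) g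
  ext σ
  exact h.smooth.character_eq_one_of_subset_twistorSpace h.bihomogeneous hZ (hG σ σ.2) (hψ σ)

lemma pact_eq_of_perm_four (hG : ∀ g ∈ G, IsRotation g) (φ : G ≃* Perm (Fin 4)) (g : G) :
    pact g.1 f = f := by
  refine h.pact_eq_of_forall_hom_eq_one hinv φ (fun ψ hψ => ?_) g
  have hsq : ψ (finRotate 4) ^ 2 = 1 := by
    rw [← map_pow]
    exact perm_hom_apply_eq_one ψ (Perm.mem_alternatingGroup.2 (by decide))
  refine perm_hom_eq_one ψ (τ := finRotate 4) (by decide) ?_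
  refine h.smooth.character_eq_one_of_sq_ne_one h.bihomogeneous
    (hG _ (φ.symm (finRotate 4)).2) (hψ (finRotate 4)) hsq fun hone => ?_
  have hone' : φ.symm (finRotate 4) ^ 2 = 1 := Subtype.ext hone
  rw [← map_pow, map_eq_one_iff _ φ.symm.injective] at hone'
  exact absurd hone' (by decide)

lemma pact_eq_of_alternatingGroup_five (φ : G ≃* alternatingGroup (Fin 5)) (g : G) :
    pact g.1 f = f :=
  h.pact_eq_of_forall_hom_eq_one hinv φ
    (fun ψ _ => alternatingGroup_hom_eq_one_of_five_le_card (by simp) ψ) g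

end Invariance

section Bounds

variable (h : EllipticModel G k f) (hfG : ∀ g : G, pact g.1 f = f) {H : Type*} [Group H]

include h hfG

lemma dvd_or_dvd (hG : ∀ g ∈ G, IsRotation g) (φ : G ≃* H) (σ : H) :
    orderOf σ ∣ k ∨ orderOf σ ∣ k - 1 := by
  have horder : orderOf (φ.symm σ).1 = orderOf σ := by
    rw [Subgroup.orderOf_coe, MulEquiv.orderOf_eq]
  rw [← horder]
  exact h.smooth.dvd_or_dvd h.bihomogeneous (by have := h.two_le; lia) (hG _ (φ.symm σ).2)
    (hfG (φ.symm σ))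

lemma sub_one_le_of_invariant {P : BiPoly} {j : ℕ} (hP : IsBihomogeneous P j j) (hj : j ≠ 0)
    (hPG : ∀ g : G, pact g.1 P = P) (hPd : toDiag P ≠ 0) : k - 1 ≤ j := by
  by_contra! hk
  obtain ⟨m, rfl⟩ := Nat.exists_eq_add_of_le' h.two_le
  obtain ⟨L, q, hq⟩ := h.exists_torusMap
  exact hq.false_of_invariant h.bihomogeneous h.smooth hfG hP hj (by lia) hPG hPd

lemma card_mul_sub_one_le_two_mul_card [Fintype H] (φ : G ≃* H) {σ : H} (hσ : σ ≠ 1)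
    {K : Finset H} (hK : PreservesAxis K σ) : K.card * (k - 1) ≤ 2 * Fintype.card H := by
  obtain ⟨j, P, hP, hj, hle, hd, hPG⟩ := exists_form_of_mulEquiv φ hσ hK
  have hP₂ : IsBihomogeneous (P ^ 2) (2 * j) (2 * j) := hP.pow 2
  have hk := h.sub_one_le_of_invariant hfG hP₂ (by lia) (fun g => by rw [map_pow, hPG])
    (by rw [map_pow]; exact pow_ne_zero 2 hd)
  calc K.card * (k - 1) ≤ K.card * (2 * j) := Nat.mul_le_mul_left _ hk
    _ = 2 * (K.card * j) := mul_left_comm _ _ _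
    _ ≤ 2 * Fintype.card H := Nat.mul_le_mul_left 2 hle

lemma card_mul_sub_one_le_card {n : ℕ} (φ : G ≃* alternatingGroup (Fin n))
    {σ : alternatingGroup (Fin n)} (hσ : σ ≠ 1) {K : Finset (alternatingGroup (Fin n))}
    (hK : PreservesAxis K σ) : K.card * (k - 1) ≤ Fintype.card (alternatingGroup (Fin n)) := by
  obtain ⟨j, P, hP, hj, hle, hd, hPG⟩ := exists_form_of_mulEquiv φ hσ hK
  have hP₀ : P ≠ 0 := fun h₀ => hd (by rw [h₀, map_zero])
  have hk := h.sub_one_le_of_invariant hfG hP hj (hP.pact_eq_of_sq_eq hP₀ hPG φ) hd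
  exact (Nat.mul_le_mul_left _ hk).trans hle

end Bounds

end EllipticModel

namespace EllipticModel

variable (h : EllipticModel G k f) (hG : ∀ g ∈ G, IsRotation g)
  (hinv : ∀ g ∈ G, ∀ p ∈ zeroLocus f, g • p ∈ zeroLocus f)

include h hG hinv

theorem degree_of_alternatingGroup_four (φ : G ≃* alternatingGroup (Fin 4))
    (hZ : zeroLocus f ⊆ twistorSpace) : k = 3 ∨ k = 4 := by
  have : Finite G := Finite.of_equiv _ φ.symm.toEquiv
  have hfG := h.pact_eq_of_subset_twistorSpace hinv hG hZ
  obtain ⟨τ, hτ⟩ := exists_orderOf_eq_three_alternatingGroup (n := 4) (by norm_num)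
  have hthree := h.dvd_or_dvd hfG hG φ τ
  rw [hτ] at hthree
  obtain ⟨σ, K, hσ, hK, hKσ⟩ := exists_preservesAxis_alternatingGroup_four
  have hbound := h.card_mul_sub_one_le_card hfG φ hσ hKσ
  have hcard : Fintype.card (alternatingGroup (Fin 4)) = 12 := by
    rw [← Nat.card_eq_fintype_card, nat_card_alternatingGroup, Nat.card_fin]; rfl
  rw [hK, hcard] at hbound
  have htwo := h.two_le
  lia

theorem degree_of_perm_four (φ : G ≃* Perm (Fin 4)) : k = 4 := by
  have : Finite G := Finite.of_equiv _ φ.symm.toEquiv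
  have hfG := h.pact_eq_of_perm_four hinv hG φ
  obtain ⟨τ, hτ⟩ := exists_orderOf_eq_three_alternatingGroup (n := 4) (by norm_num)
  have hthree := h.dvd_or_dvd hfG hG φ τ
  have hfour := h.dvd_or_dvd hfG hG φ (finRotate 4)
  rw [Subgroup.orderOf_coe, hτ] at hthree
  rw [orderOf_finRotate_four] at hfour
  obtain ⟨σ, K, hσ, hK, hKσ⟩ := exists_preservesAxis_perm_four
  have hbound := h.card_mul_sub_one_le_two_mul_card hfG φ hσ hKσ
  have hcard : Fintype.card (Perm (Fin 4)) = 24 := by rw [Fintype.card_perm, Fintype.card_fin]; rfl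
  rw [hK, hcard] at hbound
  have htwo := h.two_le
  lia

theorem degree_of_alternatingGroup_five (φ : G ≃* alternatingGroup (Fin 5)) : k = 6 := by
  have : Finite G := Finite.of_equiv _ φ.symm.toEquiv
  have hfG := h.pact_eq_of_alternatingGroup_five hinv φ
  obtain ⟨τ, hτ⟩ := exists_orderOf_eq_three_alternatingGroup (n := 5) (by norm_num)
  have hthree := h.dvd_or_dvd hfG hG φ τ
  have hfive := h.dvd_or_dvd hfG hG φ fiveCycle
  rw [hτ] at hthree
  rw [orderOf_fiveCycle] at hfive
  obtain ⟨σ, K, hσ, hK, hKσ⟩ := exists_preservesAxis_alternatingGroup_five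
  have hbound := h.card_mul_sub_one_le_card hfG φ hσ hKσ
  have hcard : Fintype.card (alternatingGroup (Fin 5)) = 60 := by
    rw [← Nat.card_eq_fintype_card, nat_card_alternatingGroup, Nat.card_fin]; rfl
  rw [hK, hcard] at hbound
  have htwo := h.two_le
  lia

end EllipticModel

end Classification

end PlatonicCurves

end

theorem proposition5p2 (k : ℕ)
    (S : Set (PlatonicCurves.P1 × PlatonicCurves.P1))
    (hS : PlatonicCurves.IsSmoothCurve k S)
    (G : Subgroup PlatonicCurves.PSL2)
    (hG : ∀ g ∈ G, PlatonicCurves.IsRotation g)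
    (hinv : ∀ g ∈ G, ∀ p ∈ S, g • p ∈ S)
    (hE : PlatonicCurves.HasEllipticQuotient G S) :
    (Nonempty (G ≃* alternatingGroup (Fin 4)) → S ⊆ PlatonicCurves.twistorSpace →
      k = 3 ∨ k = 4) ∧
    (Nonempty (G ≃* Equiv.Perm (Fin 4)) → k = 4) ∧
    (Nonempty (G ≃* alternatingGroup (Fin 5)) → k = 6) := by
  obtain ⟨f, hf, rfl⟩ := hS.exists_ellipticModel hE
  exact ⟨fun ⟨φ⟩ hZ => hf.degree_of_alternatingGroup_four hG hinv φ hZ,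
    fun ⟨φ⟩ => hf.degree_of_perm_four hG hinv φ,
    fun ⟨φ⟩ => hf.degree_of_alternatingGroup_five hG hinv φ⟩
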